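/- Consider the complex AWGN channel $Y=x+Z$, where $x\in\mathbb{C}^n$ and $Z\sim\mathcal{CN}(0,I_n)$. A code of blocklength $n$ with $M$ messages consists of codewords $c_1,\dots,c_M\in\mathbb{C}^n$ and a (measurable) decoder $g:\mathbb{C}^n\to\{1,\dots,M\}$; its average error probability is $\frac1M\sum_{j=1}^M \Pr[g(c_j+Z)\ne j]$. It satisfies the long-term power constraint $\rho$ if $\frac1M\sum_{j=1}^M\|c_j\|^2\le n\rho$, and the short-term power constraint $\rho$ if $\|c_j\|^2\le n\rho$ for every $j$. Let $R^*(n,\varepsilon)$ be the supremum of $\frac{\ln M}{n}$ over all codes of blocklength $n$ with long-term power constraint $\rho$ and average error probability at most $\varepsilon$, and let $R^*_{\mathrm{st}}(n,P,\delta)$ be the supremum of $\frac{\ln M}{n}$ over all codes of blocklength $n$ with short-term power constraint $P$ and average error probability at most $\delta$. Put $C(x)=\ln(1+x)$ and $V(x)=\frac{x(x+2)}{(1+x)^2}$. Fix $\rho>0$ and $0<\varepsilon<1$. Then $R^*(n,\varepsilon)<\infty$ for every $n\ge1$ and, as $n\to\infty$, $$R^*(n,\varepsilon)=C\Big(\frac{\rho}{1-\varepsilon}\Big)-\sqrt{V\Big(\frac{\rho}{1-\varepsilon}\Big)}\sqrt{\frac{\ln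 n}{n}}+O\Big(\frac1{\sqrt n}\Big).$$ Moreover, this rate is achieved by padding a short-term code with zeros: there are integers $K_n\le M_n$, real numbers $P_n=\frac{\rho}{1-\varepsilon}+O\big(\frac1{\sqrt{n\ln n}}\big)$ and $\delta_n=O\big(\frac1{\sqrt{n\ln n}}\big)$, and codes of blocklength $n$ with $K_n$ messages such that, for all sufficiently large $n$, the code satisfies the short-term power constraint $P_n$ and has average error probability at most $\delta_n$, and the code with $M_n$ messages obtained from it by adding $M_n-K_n$ all-zero codewords, with the decoder unchanged, satisfies the long-term power constraint $\rho$ and has average error probability at most $\varepsilon$. The short-term codes are optimal to second order, $\frac{\ln K_n}{n}=R^*_{\mathrm{st}}(n,P_n,\delta_n)+O\big(\frac1{\sqrt n}\big)$; the fraction of zero codewords is $\frac{M_n-K_n}{M_n}=\varepsilon+O\big(\frac1{\sqrt{n\ln n}}\big)$; and $$\frac{\ln M_n}{n}=C\Big(\frac{\rho}{1-\varepsilon}\Big)-\sqrt{V\Big(\frac{\rho}{1-\varepsilon}\Big)}\sqrt{\frac{\ln n}{n}}+O\Big(\frac1{\sqrt n}\Big).$$ -/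

import Mathlib

open MeasureTheory ProbabilityTheory Filter Asymptotics

/-- The circularly symmetric complex Gaussian law `CN(0, 1)`: independent real and imaginary
parts, each normal with mean `0` and variance `1/2`. -/
noncomputable def stdComplexGaussian : Measure ℂ :=
  ((gaussianReal 0 (1 / 2)).prod (gaussianReal 0 (1 / 2))).map
    fun p : ℝ × ℝ => (⟨p.1, p.2⟩ : ℂ)

/-- The law `CN(0, I_n)` of the noise vector. -/
noncomputable def awgnNoise (n : ℕ) : Measure (Fin n → ℂ) :=
  Measure.pi fun _ => stdComplexGaussian

/-- A channel code with blocklength `n` and `M` messages: an encoder (the list of codewords) and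
a measurable decoder. -/
structure ChannelCode (n M : ℕ) where
  /-- the codeword of each message -/
  enc : Fin M → Fin n → ℂ
  /-- the message decoded from each channel output -/
  dec : (Fin n → ℂ) → Fin M
  measurable_dec : Measurable dec

namespace ChannelCode

variable {n M : ℕ}

/-- Squared Euclidean norm of the codeword of message `j`. -/
noncomputable def energy (c : ChannelCode n M) (j : Fin M) : ℝ :=
  ∑ i, ‖c.enc j i‖ ^ 2

/-- Long-term power constraint: the codeword power, averaged over the messages, is at most
`ρ`. -/
def LongTermPower (c : ChannelCode n M) (ρ : ℝ) : Prop :=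
  (1 / (M : ℝ)) * ∑ j, c.energy j ≤ n * ρ

/-- Short-term power constraint: the power of each codeword is at most `ρ`. -/
def ShortTermPower (c : ChannelCode n M) (ρ : ℝ) : Prop :=
  ∀ j, c.energy j ≤ n * ρ

/-- Average error probability over the channel `Y = x + Z` with equiprobable messages. -/
noncomputable def avgError (c : ChannelCode n M) : ℝ :=
  (1 / (M : ℝ)) * ∑ j, (awgnNoise n).real {z | c.dec (c.enc j + z) ≠ j}

/-- Add `M' - M` all-zero codewords and leave the decoder unchanged. -/
def padZero (c : ChannelCode n M) {M' : ℕ} (h : M ≤ M') : ChannelCode n M' where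
  enc j := if hj : (j : ℕ) < M then c.enc ⟨j, hj⟩ else 0
  dec y := Fin.castLE h (c.dec y)
  measurable_dec := (measurable_of_countable (Fin.castLE h)).comp c.measurable_dec

end ChannelCode

/-- The rates `ln M / n` of the codes of blocklength `n` with long-term power at most `ρ` and
average error probability at most `ε`. -/
def longTermRates (ρ : ℝ) (n : ℕ) (ε : ℝ) : Set ℝ :=
  {r | ∃ (M : ℕ) (c : ChannelCode n M),
    c.LongTermPower ρ ∧ c.avgError ≤ ε ∧ r = Real.log M / n}

/-- The rates `ln M / n` of the codes of blocklength `n` with short-term power at most `ρ` and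
average error probability at most `ε`. -/
def shortTermRates (ρ : ℝ) (n : ℕ) (ε : ℝ) : Set ℝ :=
  {r | ∃ (M : ℕ) (c : ChannelCode n M),
    c.ShortTermPower ρ ∧ c.avgError ≤ ε ∧ r = Real.log M / n}

/-- The maximal channel coding rate under the long-term power constraint `ρ`. -/
noncomputable def maxLongTermRate (ρ : ℝ) (n : ℕ) (ε : ℝ) : ℝ := sSup (longTermRates ρ n ε)

/-- The maximal channel coding rate under the short-term power constraint `ρ`. -/
noncomputable def maxShortTermRate (ρ : ℝ) (n : ℕ) (ε : ℝ) : ℝ := sSup (shortTermRates ρ n ε)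

/-- Capacity of the complex AWGN channel, in nats. -/
noncomputable def awgnCapacity (x : ℝ) : ℝ := Real.log (1 + x)

/-- Dispersion of the complex AWGN channel. -/
noncomputable def awgnDispersion (x : ℝ) : ℝ := x * (x + 2) / (1 + x) ^ 2

/-- The two leading terms `C(ρ/(1-ε)) - √V(ρ/(1-ε)) √(ln n / n)`. -/
noncomputable def awgnSecondOrder (ρ ε : ℝ) (n : ℕ) : ℝ :=
  awgnCapacity (ρ / (1 - ε))
    - Real.sqrt (awgnDispersion (ρ / (1 - ε))) * Real.sqrt (Real.log n / n)

/-! Put P = ρ/(1-ε), V = `awgnDispersion P`, q = √n, L = √(ln n). For an input of energy e, the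
information density relative to the output law CN(0, 1+P), less n ln(1+P), has mean -(nP-e)/(1+P)
and, for e near nP, variance about nV. Its cumulant generating function is explicit, so tail
estimates follow from exponential tilting, without a central limit theorem.

Converse. The meta-converse bounds M(1 - error) by the sum over codewords of f(e) = Pr[`excessInfo`
> g], plus (1+P)^n exp g. With g = -q(√V L - 13), f is close to a step at e = nP, and
`eventually_excessInfo_gt_le` puts it below the line (1 - 1/q) e/(nP) + 1/n. A linear bound sees
only the average energy, so the sum is at most M((1 - 1/q)(1-ε) + 1/n). The slack of order M/q,
weakened to M/n, must be covered by (1+P)^n exp g; this costs ln n ≤ q in ln M. The factor √V in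
front of √(n ln n) is the place where 1 - f(nP) exceeds 1/q by enough for the line to stay above f.

Achievability. Feinstein's greedy construction (`exists_codewords_of_card_mul_lt`), on a shell of
Gaussian inputs just inside energy nP, gives K codewords with error δ = 1/(qL) and ln K within O(√n)
of the same expression. Zero codewords, all counted as errors, are then added until they form a
fraction about ε; the average power drops from P to ρ.

Short-term codes are also long-term codes, so the same converse (`eventually_log_card_le`) shows
that the short-term codes are second-order optimal. -/

/-! ### Gaussian integrals and the density of the noise. -/

/-- Squared Euclidean norm of a complex vector. -/
noncomputable def normSqSum {n : ℕ} (z : Fin n → ℂ) : ℝ := ∑ i, ‖z i‖ ^ 2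

lemma normSqSum_nonneg {n : ℕ} (z : Fin n → ℂ) : 0 ≤ normSqSum z :=
  Finset.sum_nonneg fun _ _ => by positivity

@[fun_prop]
lemma measurable_normSqSum {n : ℕ} : Measurable (normSqSum (n := n)) := by
  unfold normSqSum
  fun_prop

lemma integrable_exp_neg_mul_normSqSum {n : ℕ} {c : ℝ} (hc : 0 < c) :
    Integrable (fun z : Fin n → ℂ => Real.exp (-c * normSqSum z)) := by
  have h1 : Integrable (fun z : ℂ => Real.exp (-c * ‖z‖ ^ 2)) := by
    have := (GaussianFourier.integrable_cexp_neg_mul_sq_norm_add (V := ℂ) (b := (c : ℂ))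
      (by simpa using hc) 0 0).norm
    refine this.congr (ae_of_all _ fun z => ?_)
    simp [Complex.norm_exp, ← Complex.ofReal_pow]
  have := Integrable.fintype_prod (f := fun (_ : Fin n) (z : ℂ) => Real.exp (-c * ‖z‖ ^ 2))
    (μ := fun _ => volume) fun _ => h1
  refine this.congr (ae_of_all _ fun z => ?_)
  simp only [normSqSum, Finset.mul_sum, Real.exp_sum]

lemma lintegral_exp_neg_mul_normSqSum {n : ℕ} {c : ℝ} (hc : 0 < c) :
    ∫⁻ z : Fin n → ℂ, ENNReal.ofReal (Real.exp (-c * normSqSum z))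
      = ENNReal.ofReal ((Real.pi / c) ^ n) := by
  rw [← ofReal_integral_eq_lintegral_ofReal (integrable_exp_neg_mul_normSqSum hc)
    (ae_of_all _ fun z => (Real.exp_pos _).le)]
  congr 1
  have h := integral_fintype_prod_volume_eq_pow (ι := Fin n)
    (fun z : ℂ => Real.exp (-c * ‖z‖ ^ 2))
  rw [GaussianFourier.integral_rexp_neg_mul_sq_norm hc] at h
  simp only [Complex.finrank_real_complex, Fintype.card_fin] at h
  norm_num at h
  rw [← h]
  refine integral_congr_ae (ae_of_all _ fun z => ?_)
  simp only [normSqSum, Finset.mul_sum, Real.exp_sum, neg_mul]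

lemma complete_square (α β : ℝ) (h : α - β ≠ 0) (x z : ℂ) :
    -α * ‖z‖ ^ 2 + β * ‖x + z‖ ^ 2
      = -(α - β) * ‖z + ((-(β / (α - β)) : ℝ) : ℂ) * x‖ ^ 2 + α * β / (α - β) * ‖x‖ ^ 2 := by
  simp only [Complex.sq_norm, Complex.normSq_apply, Complex.add_re, Complex.add_im,
    Complex.re_ofReal_mul, Complex.im_ofReal_mul]
  field_simp
  ring

/-- The Gaussian integral with a displaced quadratic term. -/
lemma lintegral_exp_quadratic {n : ℕ} {α β : ℝ} (h : β < α) (x : Fin n → ℂ) :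
    ∫⁻ z : Fin n → ℂ, ENNReal.ofReal (Real.exp (-α * normSqSum z + β * normSqSum (x + z)))
      = ENNReal.ofReal ((Real.pi / (α - β)) ^ n
          * Real.exp (α * β / (α - β) * normSqSum x)) := by
  have h0 : 0 < α - β := sub_pos.2 h
  set w : Fin n → ℂ := fun i => ((-(β / (α - β)) : ℝ) : ℂ) * x i with hw
  have key (z : Fin n → ℂ) : ENNReal.ofReal
      (Real.exp (-α * normSqSum z + β * normSqSum (x + z)))
      = ENNReal.ofReal (Real.exp (-(α - β) * normSqSum (z + w)))
        * ENNReal.ofReal (Real.exp (α * β / (α - β) * normSqSum x)) := by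
    rw [← ENNReal.ofReal_mul (Real.exp_pos _).le, ← Real.exp_add]
    congr 2
    simp only [normSqSum, Finset.mul_sum, ← Finset.sum_add_distrib]
    exact Finset.sum_congr rfl fun i _ => complete_square α β h0.ne' (x i) (z i)
  simp_rw [key]
  rw [lintegral_mul_const _ (by fun_prop),
    lintegral_add_right_eq_self (μ := (volume : Measure (Fin n → ℂ)))
      (fun z => ENNReal.ofReal (Real.exp (-(α - β) * normSqSum z))) w,
    lintegral_exp_neg_mul_normSqSum h0, ENNReal.ofReal_mul (by positivity)]

lemma stdComplexGaussian_eq_withDensity :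
    stdComplexGaussian
      = volume.withDensity fun z : ℂ => ENNReal.ofReal (Real.pi⁻¹ * Real.exp (-‖z‖ ^ 2)) := by
  have hv : (1 / 2 : NNReal) ≠ 0 := by norm_num
  have hmap : (fun p : ℝ × ℝ => (⟨p.1, p.2⟩ : ℂ)) = Complex.measurableEquivRealProd.symm := rfl
  rw [stdComplexGaussian, gaussianReal_of_var_ne_zero _ hv,
    prod_withDensity (measurable_gaussianPDF _ _) (measurable_gaussianPDF _ _), hmap]
  ext s hs
  rw [MeasurableEquiv.map_apply, withDensity_apply _
    (Complex.measurableEquivRealProd.symm.measurable hs), withDensity_apply _ hs,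
    ← Complex.volume_preserving_equiv_real_prod.symm.setLIntegral_comp_preimage hs
      (by fun_prop)]
  refine lintegral_congr fun p => ?_
  rw [gaussianPDF, gaussianPDF, ← ENNReal.ofReal_mul (gaussianPDFReal_nonneg _ _ _)]
  congr 1
  have : ‖Complex.measurableEquivRealProd.symm p‖ ^ 2 = p.1 ^ 2 + p.2 ^ 2 := by
    rw [Complex.sq_norm, Complex.normSq_apply]
    simp [Complex.measurableEquivRealProd_symm_apply, sq]
  rw [this]
  simp only [gaussianPDFReal]
  have h2 : (2 * Real.pi * ((1 / 2 : NNReal) : ℝ)) = Real.pi := by push_cast; ring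
  have h3 : (2 * ((1 / 2 : NNReal) : ℝ)) = 1 := by push_cast; ring
  rw [h2, h3, mul_mul_mul_comm, ← Real.exp_add, ← mul_inv, Real.mul_self_sqrt Real.pi_pos.le]
  congr 2
  ring

instance : IsProbabilityMeasure stdComplexGaussian := by
  unfold stdComplexGaussian
  exact Measure.isProbabilityMeasure_map
    (Complex.measurableEquivRealProd.symm.measurable.aemeasurable)

instance (n : ℕ) : IsProbabilityMeasure (awgnNoise n) := by
  unfold awgnNoise; infer_instance

lemma awgnNoise_eq_withDensity (n : ℕ) :
    awgnNoise n = volume.withDensity fun z : Fin n → ℂ =>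
      ENNReal.ofReal (Real.pi⁻¹ ^ n * Real.exp (-normSqSum z)) := by
  rw [awgnNoise]
  have hint : Integrable (fun z : ℂ => Real.pi⁻¹ * Real.exp (-‖z‖ ^ 2)) := by
    have := (integrable_exp_neg_mul_normSqSum (n := 1) one_pos)
    have h2 := ((volume_preserving_funUnique (Fin 1) ℂ).symm.integrable_comp_emb
      (MeasurableEquiv.measurableEmbedding _) (g := fun z => Real.exp (-1 * normSqSum z))).2 this
    refine (h2.congr (ae_of_all _ fun z => ?_)).const_mul _
    simp [normSqSum]
  refine Measure.pi_eq (μ := fun _ : Fin n => stdComplexGaussian) fun s hs => ?_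
  rw [withDensity_apply _ (MeasurableSet.univ_pi hs), volume_pi, Measure.restrict_pi_pi]
  have e (z : Fin n → ℂ) : Real.pi⁻¹ ^ n * Real.exp (-normSqSum z)
      = ∏ i, (Real.pi⁻¹ * Real.exp (-‖z i‖ ^ 2)) := by
    simp [normSqSum, Finset.prod_mul_distrib, Finset.prod_const, ← Real.exp_sum]
  simp_rw [e]
  rw [← ofReal_integral_eq_lintegral_ofReal]
  · rw [integral_fintype_prod_eq_prod (fun (_ : Fin n) (z : ℂ) =>
      Real.pi⁻¹ * Real.exp (-‖z‖ ^ 2)), ENNReal.ofReal_prod_of_nonneg]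
    · refine Finset.prod_congr rfl fun i _ => ?_
      rw [stdComplexGaussian_eq_withDensity, withDensity_apply _ (hs i),
        ofReal_integral_eq_lintegral_ofReal hint.restrict
          (ae_of_all _ fun z => by positivity)]
    · intro i _
      exact integral_nonneg fun z => by positivity
  · exact Integrable.fintype_prod (f := fun (_ : Fin n) (z : ℂ) =>
      Real.pi⁻¹ * Real.exp (-‖z‖ ^ 2)) fun i => hint.restrict
  · exact ae_of_all _ fun z => Finset.prod_nonneg fun i _ => by positivity

/-! ### Information density, its generating function and changes of measure. -/

/-- The circularly symmetric complex Gaussian law with variance `v` in each coordinate. -/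
noncomputable def gaussianVector (n : ℕ) (v : ℝ) : Measure (Fin n → ℂ) :=
  volume.withDensity fun y =>
    ENNReal.ofReal ((Real.pi * v)⁻¹ ^ n * Real.exp (-(1 / v) * normSqSum y))

/-- The centred information density `‖x + z‖² / (1 + P) - ‖z‖²` of the AWGN channel with input `x`
and noise `z`, relative to the output law with variance `1 + P`. -/
noncomputable def excessInfo (P : ℝ) {n : ℕ} (x z : Fin n → ℂ) : ℝ :=
  normSqSum (x + z) / (1 + P) - normSqSum z

@[fun_prop]
lemma measurable_excessInfo (P : ℝ) {n : ℕ} (x : Fin n → ℂ) : Measurable (excessInfo P x) := by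
  unfold excessInfo
  fun_prop

/-- The cumulant generating function of `excessInfo` for an input of energy `e`. -/
noncomputable def excessCgf (n : ℕ) (P e θ : ℝ) : ℝ :=
  -(n * Real.log (1 + θ * (P / (1 + P))))
    + e * ((1 + θ) * (θ / (1 + P)) / (1 + θ * (P / (1 + P))))

lemma lintegral_gaussianVector {n : ℕ} (v : ℝ) {f : (Fin n → ℂ) → ENNReal} (hf : Measurable f) :
    ∫⁻ y, f y ∂gaussianVector n v = ∫⁻ y, ENNReal.ofReal ((Real.pi * v)⁻¹ ^ n
      * Real.exp (-(1 / v) * normSqSum y)) * f y := by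
  rw [gaussianVector, lintegral_withDensity_eq_lintegral_mul _ (by fun_prop) hf]
  rfl

lemma lintegral_awgnNoise {n : ℕ} {f : (Fin n → ℂ) → ENNReal} (hf : Measurable f) :
    ∫⁻ y, f y ∂awgnNoise n = ∫⁻ y, ENNReal.ofReal (Real.pi⁻¹ ^ n
      * Real.exp (-normSqSum y)) * f y := by
  rw [awgnNoise_eq_withDensity, lintegral_withDensity_eq_lintegral_mul _ (by fun_prop) hf]
  rfl

/-- The exponent is quadratic in the noise, so completing the square gives an exact value. It
depends on the input through its energy alone, which makes all later tail bounds uniform over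
codewords. -/
lemma lintegral_exp_excessInfo {n : ℕ} {P θ : ℝ} (hP : 0 < P) (h : 0 < 1 + θ * (P / (1 + P)))
    (x : Fin n → ℂ) :
    ∫⁻ z, ENNReal.ofReal (Real.exp (θ * excessInfo P x z)) ∂awgnNoise n
      = ENNReal.ofReal (Real.exp (excessCgf n P (normSqSum x) θ)) := by
  rw [lintegral_awgnNoise (by fun_prop)]
  have hden : (1 + θ) - θ / (1 + P) = 1 + θ * (P / (1 + P)) := by field_simp; ring
  have hlt : θ / (1 + P) < 1 + θ := by linarith
  have e (z : Fin n → ℂ) : ENNReal.ofReal (Real.pi⁻¹ ^ n * Real.exp (-normSqSum z))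
      * ENNReal.ofReal (Real.exp (θ * excessInfo P x z))
      = ENNReal.ofReal (Real.pi⁻¹ ^ n) * ENNReal.ofReal (Real.exp (-(1 + θ) * normSqSum z
        + θ / (1 + P) * normSqSum (x + z))) := by
    rw [← ENNReal.ofReal_mul (by positivity), ← ENNReal.ofReal_mul (by positivity), mul_assoc,
      ← Real.exp_add]
    congr 3
    unfold excessInfo
    ring
  simp_rw [e]
  rw [lintegral_const_mul _ (by fun_prop), lintegral_exp_quadratic hlt,
    ← ENNReal.ofReal_mul (by positivity), hden, ← mul_assoc, ← mul_pow]
  congr 1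
  have h1 : Real.pi⁻¹ * (Real.pi / (1 + θ * (P / (1 + P)))) = (1 + θ * (P / (1 + P)))⁻¹ := by
    field_simp
  rw [h1, excessCgf, Real.exp_add, Real.exp_neg, ← Real.log_pow, Real.exp_log (by positivity),
    inv_pow, mul_comm (normSqSum x)]

lemma lintegral_exp_normSqSum {n : ℕ} {P θ : ℝ} (hP : 0 < P) (h : 0 < 1 - θ * P) :
    ∫⁻ x, ENNReal.ofReal (Real.exp (θ * normSqSum x)) ∂gaussianVector n P
      = ENNReal.ofReal (Real.exp (-(n * Real.log (1 - θ * P)))) := by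
  rw [lintegral_gaussianVector _ (by fun_prop)]
  have hc : 0 < 1 / P - θ := by
    have : 1 / P - θ = (1 - θ * P) / P := by field_simp
    rw [this]; positivity
  have e (z : Fin n → ℂ) : ENNReal.ofReal ((Real.pi * P)⁻¹ ^ n
      * Real.exp (-(1 / P) * normSqSum z)) * ENNReal.ofReal (Real.exp (θ * normSqSum z))
      = ENNReal.ofReal ((Real.pi * P)⁻¹ ^ n)
        * ENNReal.ofReal (Real.exp (-(1 / P - θ) * normSqSum z)) := by
    rw [← ENNReal.ofReal_mul (by positivity), ← ENNReal.ofReal_mul (by positivity), mul_assoc,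
      ← Real.exp_add]
    congr 3
    ring
  simp_rw [e]
  rw [lintegral_const_mul _ (by fun_prop), lintegral_exp_neg_mul_normSqSum hc,
    ← ENNReal.ofReal_mul (by positivity), ← mul_pow, Real.exp_neg, ← Real.log_pow,
    Real.exp_log (by positivity), ← inv_pow]
  congr 2
  field_simp

lemma isProbabilityMeasure_gaussianVector (n : ℕ) {v : ℝ} (hv : 0 < v) :
    IsProbabilityMeasure (gaussianVector n v) := by
  refine ⟨?_⟩
  have := lintegral_exp_normSqSum (n := n) (θ := 0) hv (by simp)
  simpa using this

lemma measurableSet_shift {n : ℕ} (x : Fin n → ℂ) {U : Set (Fin n → ℂ)} (hU : MeasurableSet U) :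
    MeasurableSet {z | x + z ∈ U} :=
  (measurable_const_add x) hU

/-- Gaussian inputs produce Gaussian outputs. -/
lemma lintegral_awgnNoise_shift {n : ℕ} {P : ℝ} (hP : 0 < P) {U : Set (Fin n → ℂ)}
    (hU : MeasurableSet U) :
    ∫⁻ x, awgnNoise n {z | x + z ∈ U} ∂gaussianVector n P = gaussianVector n (1 + P) U := by
  set w : (Fin n → ℂ) → ENNReal := fun z =>
    ENNReal.ofReal (Real.pi⁻¹ ^ n * Real.exp (-normSqSum z)) with hw
  have hwm : Measurable w := by fun_prop
  set F : (Fin n → ℂ) → ENNReal := U.indicator 1 with hF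
  have hFm : Measurable F := measurable_one.indicator hU
  have h1 (x : Fin n → ℂ) : awgnNoise n {z | x + z ∈ U} = ∫⁻ y, w (y - x) * F y := by
    have : ∫⁻ z, F (x + z) ∂awgnNoise n = awgnNoise n {z | x + z ∈ U} := by
      rw [← lintegral_indicator_one (measurableSet_shift x hU)]
      rfl
    have hFs : Measurable fun z => F (x + z) := hFm.comp (measurable_const_add x)
    rw [← this, lintegral_awgnNoise hFs,
      ← lintegral_add_left_eq_self (μ := (volume : Measure (Fin n → ℂ)))
        (fun y => w (y - x) * F y) x]
    simp [hw]
  simp_rw [h1]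
  have hwm2 : Measurable (Function.uncurry fun x y : Fin n → ℂ => w (y - x) * F y) :=
    (hwm.comp (measurable_snd.sub measurable_fst)).mul (hFm.comp measurable_snd)
  rw [lintegral_gaussianVector _ hwm2.lintegral_prod_right]
  have h2 (x : Fin n → ℂ) : ENNReal.ofReal ((Real.pi * P)⁻¹ ^ n
        * Real.exp (-(1 / P) * normSqSum x)) * ∫⁻ y, w (y - x) * F y
      = ∫⁻ y, ENNReal.ofReal ((Real.pi * P)⁻¹ ^ n * Real.exp (-(1 / P) * normSqSum x))
          * (w (y - x) * F y) := by
    rw [lintegral_const_mul]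
    exact (hwm.comp (measurable_id.sub_const x)).mul hFm
  simp_rw [h2]
  rw [lintegral_lintegral_swap]
  · have h3 (y : Fin n → ℂ) : ∫⁻ x, ENNReal.ofReal ((Real.pi * P)⁻¹ ^ n
          * Real.exp (-(1 / P) * normSqSum x)) * (w (y - x) * F y)
        = ENNReal.ofReal ((Real.pi * (1 + P))⁻¹ ^ n
          * Real.exp (-(1 / (1 + P)) * normSqSum y)) * F y := by
      rw [← lintegral_add_left_eq_self (μ := (volume : Measure (Fin n → ℂ))) _ y]
      have e (z : Fin n → ℂ) : ENNReal.ofReal ((Real.pi * P)⁻¹ ^ n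
          * Real.exp (-(1 / P) * normSqSum (y + z))) * (w (y - (y + z)) * F y)
          = ENNReal.ofReal (Real.exp (-1 * normSqSum z + (-(1 / P)) * normSqSum (y + z)))
            * (ENNReal.ofReal ((Real.pi * P)⁻¹ ^ n * Real.pi⁻¹ ^ n) * F y) := by
        have hneg : normSqSum (y - (y + z)) = normSqSum z := by simp [normSqSum]
        simp only [hw, hneg]
        rw [← mul_assoc, ← mul_assoc, ← ENNReal.ofReal_mul (by positivity),
          ← ENNReal.ofReal_mul (by positivity), Real.exp_add]
        congr 2
        rw [neg_one_mul]
        ring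
      simp_rw [e]
      have hd : 1 - -(1 / P) = (1 + P) / P := by
        field_simp
        ring
      rw [lintegral_mul_const _ (by fun_prop), lintegral_exp_quadratic (by
        have : 0 < 1 / P := by positivity
        linarith), hd, ← mul_assoc, ← ENNReal.ofReal_mul (by positivity)]
      congr 2
      have e1 : 1 * -(1 / P) / ((1 + P) / P) = -(1 / (1 + P)) := by
        field_simp
      have e2 : Real.pi / ((1 + P) / P) * ((Real.pi * P)⁻¹ * Real.pi⁻¹)
          = (Real.pi * (1 + P))⁻¹ := by
        field_simp
      rw [e1, ← e2, mul_pow, mul_pow]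
      ring
    simp_rw [h3]
    rw [← lintegral_gaussianVector _ hFm, hF, lintegral_indicator_one hU]
  · refine Measurable.aemeasurable ?_
    exact Measurable.mul (f := fun p : (Fin n → ℂ) × (Fin n → ℂ) =>
      ENNReal.ofReal ((Real.pi * P)⁻¹ ^ n * Real.exp (-(1 / P) * normSqSum p.1)))
      (by fun_prop) hwm2

/-- Change of measure from the channel output law to the Gaussian output law. -/
lemma awgnNoise_shift_le {n : ℕ} {P : ℝ} (hP : 0 < P) (x : Fin n → ℂ) (g : ℝ)
    {D : Set (Fin n → ℂ)} (hD : MeasurableSet D) :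
    awgnNoise n {z | x + z ∈ D} ≤ awgnNoise n {z | g < excessInfo P x z}
      + ENNReal.ofReal ((1 + P) ^ n * Real.exp g) * gaussianVector n (1 + P) D := by
  have hsub : {z | x + z ∈ D} ⊆ {z | g < excessInfo P x z}
      ∪ ({z | x + z ∈ D} ∩ {z | excessInfo P x z ≤ g}) := by
    intro z hz
    by_cases h : g < excessInfo P x z
    · exact Or.inl h
    · exact Or.inr ⟨hz, not_lt.1 h⟩
  refine (measure_mono hsub).trans ((measure_union_le _ _).trans (add_le_add le_rfl ?_))
  have hm : MeasurableSet ({z | x + z ∈ D} ∩ {z | excessInfo P x z ≤ g}) :=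
    (measurableSet_shift x hD).inter (measurableSet_le (by fun_prop) measurable_const)
  set F : (Fin n → ℂ) → ENNReal := D.indicator 1 with hF
  have hFm : Measurable F := measurable_one.indicator hD
  have hQ : gaussianVector n (1 + P) D = ∫⁻ z, ENNReal.ofReal ((Real.pi * (1 + P))⁻¹ ^ n
      * Real.exp (-(1 / (1 + P)) * normSqSum (x + z))) * F (x + z) := by
    rw [← lintegral_indicator_one hD, lintegral_gaussianVector _ hFm,
      ← lintegral_add_left_eq_self _ x]
  have hFs : Measurable fun z => F (x + z) := hFm.comp (measurable_const_add x)
  rw [hQ, ← lintegral_const_mul _ (by fun_prop), ← lintegral_indicator_one hm,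
    lintegral_awgnNoise (measurable_one.indicator hm)]
  refine lintegral_mono fun z => ?_
  by_cases hz : z ∈ {z | x + z ∈ D} ∩ {z | excessInfo P x z ≤ g}
  · rw [Set.indicator_of_mem hz, hF, Set.indicator_of_mem (show x + z ∈ D from hz.1)]
    simp only [Pi.one_apply, mul_one]
    rw [← ENNReal.ofReal_mul (by positivity)]
    refine ENNReal.ofReal_le_ofReal ?_
    have h2 : excessInfo P x z ≤ g := hz.2
    have h3 : (1 + P) ^ n * Real.exp g * ((Real.pi * (1 + P))⁻¹ ^ n
        * Real.exp (-(1 / (1 + P)) * normSqSum (x + z)))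
        = Real.pi⁻¹ ^ n * Real.exp (g - normSqSum (x + z) / (1 + P)) := by
      rw [mul_inv, mul_pow, sub_eq_add_neg, Real.exp_add]
      have : (1 + P) ^ n * (1 + P)⁻¹ ^ n = 1 := by
        rw [← mul_pow, mul_inv_cancel₀ (by positivity), one_pow]
      have h4 : -(1 / (1 + P)) * normSqSum (x + z) = -(normSqSum (x + z) / (1 + P)) := by ring
      rw [h4]
      linear_combination (Real.exp g * Real.pi⁻¹ ^ n
        * Real.exp (-(normSqSum (x + z) / (1 + P)))) * this
    rw [h3]
    gcongr
    unfold excessInfo at h2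
    linarith
  · rw [Set.indicator_of_notMem hz]
    simp

/-- The Gaussian output law gives little mass to outputs of large information density. -/
lemma gaussianVector_excessInfo_le {n : ℕ} {P : ℝ} (hP : 0 < P) (x : Fin n → ℂ) (g : ℝ) :
    gaussianVector n (1 + P) {y | g < excessInfo P x (y - x)}
      ≤ ENNReal.ofReal (((1 + P) ^ n * Real.exp g)⁻¹) := by
  have hm : MeasurableSet {y | g < excessInfo P x (y - x)} :=
    measurableSet_lt measurable_const
      ((measurable_excessInfo P x).comp (measurable_id.sub_const x))
  rw [← lintegral_indicator_one hm, lintegral_gaussianVector _ (measurable_one.indicator hm),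
    ← lintegral_add_left_eq_self _ x]
  calc _ ≤ ∫⁻ z, ENNReal.ofReal (((1 + P) ^ n * Real.exp g)⁻¹)
        * (ENNReal.ofReal (Real.pi⁻¹ ^ n * Real.exp (-normSqSum z)) * 1) := by
        refine lintegral_mono fun z => ?_
        by_cases hz : x + z ∈ {y | g < excessInfo P x (y - x)}
        · rw [Set.indicator_of_mem hz]
          simp only [Pi.one_apply, mul_one]
          rw [← ENNReal.ofReal_mul (by positivity)]
          refine ENNReal.ofReal_le_ofReal ?_
          have h2 : g < excessInfo P x z := by simpa using hz
          have h3 : ((1 + P) ^ n * Real.exp g)⁻¹ * (Real.pi⁻¹ ^ n * Real.exp (-normSqSum z))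
              = (Real.pi * (1 + P))⁻¹ ^ n * Real.exp (-g - normSqSum z) := by
            rw [mul_inv, mul_inv, mul_pow, sub_eq_add_neg, Real.exp_add, Real.exp_neg g, inv_pow]
            ring
          rw [h3]
          gcongr
          unfold excessInfo at h2
          have : -(1 / (1 + P)) * normSqSum (x + z) = -(normSqSum (x + z) / (1 + P)) := by ring
          linarith
        · rw [Set.indicator_of_notMem hz]
          simp
    _ = ENNReal.ofReal (((1 + P) ^ n * Real.exp g)⁻¹) := by
        rw [lintegral_const_mul _ (by fun_prop), ← lintegral_awgnNoise measurable_const]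
        simp

/-! ### Quadratic expansion of cumulant generating functions and tilting bounds. -/

lemma abs_log_one_sub_add_le {x : ℝ} (hx : |x| ≤ 1 / 2) :
    |x + x ^ 2 / 2 + Real.log (1 - x)| ≤ 2 * |x| ^ 3 := by
  have h := Real.abs_log_sub_add_sum_range_le (x := x) (by linarith) 2
  simp only [Finset.sum_range_succ, Finset.sum_range_zero] at h
  norm_num at h
  refine h.trans ?_
  rw [div_le_iff₀ (by linarith)]
  nlinarith [pow_nonneg (abs_nonneg x) 3]

/-- Second-order expansion of the cumulant generating function of the information density. -/
lemma abs_excessCgf_sub_le (n : ℕ) {P e θ : ℝ} (hP : 0 < P) (he : 0 ≤ e) (hθ : |θ| ≤ 1 / 2) :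
    |excessCgf n P e θ - (-((n * P - e) / (1 + P)) * θ + n * awgnDispersion P * θ ^ 2 / 2)|
      ≤ (2 * n + 2 * e) * |θ| ^ 3 + |n * P - e| * θ ^ 2 := by
  set a : ℝ := 1 / (1 + P) with ha
  set b : ℝ := P / (1 + P) with hb
  have hab : a + b = 1 := by rw [ha, hb]; field_simp
  have ha0 : 0 < a := by positivity
  have hb0 : 0 < b := by positivity
  have hbP : b = P * a := by rw [ha, hb]; ring
  have hy : |θ * b| ≤ |θ| := by
    rw [abs_mul, abs_of_pos hb0]
    nlinarith [abs_nonneg θ]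
  have hlog := abs_log_one_sub_add_le (x := -(θ * b)) (by rw [abs_neg]; linarith)
  rw [abs_neg, sub_neg_eq_add] at hlog
  have hlog' : |-(θ * b) + (-(θ * b)) ^ 2 / 2 + Real.log (1 + θ * b)| ≤ 2 * |θ| ^ 3 :=
    hlog.trans (by gcongr)
  have hden : 1 / 2 ≤ 1 + θ * b := by
    have := neg_abs_le (θ * b)
    linarith
  have hden0 : 0 < 1 + θ * b := by linarith
  have hquot : |θ ^ 2 * a ^ 2 * (θ * b) / (1 + θ * b)| ≤ 2 * |θ| ^ 3 := by
    rw [abs_div, abs_of_pos hden0, div_le_iff₀ hden0, abs_mul, abs_mul, abs_of_nonneg (sq_nonneg a),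
      abs_pow]
    have h1 : a ^ 2 ≤ 1 := by nlinarith
    calc |θ| ^ 2 * a ^ 2 * |θ * b| ≤ |θ| ^ 2 * 1 * |θ| := by gcongr
      _ = 2 * |θ| ^ 3 * (1 / 2) := by ring
      _ ≤ _ := by gcongr
  -- Since a + b = 1, 1 + θ = (1 + θb) + θa; this separates the quadratic part of the rational term
  -- from a cubic remainder.
  have hexp : (1 + θ) * (θ / (1 + P)) / (1 + θ * b)
      = θ * a + θ ^ 2 * a ^ 2 - θ ^ 2 * a ^ 2 * (θ * b) / (1 + θ * b) := by
    have h1 : θ / (1 + P) = θ * a := by rw [ha]; ring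
    have h2 : 1 + θ = (1 + θ * b) + θ * a := by linear_combination (-θ) * hab
    rw [h1, h2]
    field_simp
    ring
  have hV : awgnDispersion P = (P ^ 2 + 2 * P) * a ^ 2 := by
    rw [awgnDispersion, ha]
    field_simp
  have key : excessCgf n P e θ - (-((n * P - e) / (1 + P)) * θ + n * awgnDispersion P * θ ^ 2 / 2)
      = -(n * (-(θ * b) + (-(θ * b)) ^ 2 / 2 + Real.log (1 + θ * b)))
        + -(e * (θ ^ 2 * a ^ 2 * (θ * b) / (1 + θ * b)))
        + -((n * P - e) * (a ^ 2 * θ ^ 2)) := by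
    have h3 : (n * P - e) / (1 + P) = (n * P - e) * a := by rw [ha]; ring
    rw [excessCgf, ← hb, hexp, hV, h3, hbP]
    ring
  rw [key]
  refine (abs_add_three _ _ _).trans ?_
  rw [abs_neg, abs_neg, abs_neg, abs_mul, abs_mul, abs_mul (n * P - e), abs_of_nonneg he,
    abs_of_nonneg (Nat.cast_nonneg n : (0 : ℝ) ≤ n), abs_of_nonneg (by positivity : 0 ≤ a ^ 2 * θ ^ 2)]
  have h1 : a ^ 2 ≤ 1 := by nlinarith
  have h2 : |n * P - e| * (a ^ 2 * θ ^ 2) ≤ |n * P - e| * (1 * θ ^ 2) := by gcongr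
  have h3 := mul_le_mul_of_nonneg_left hlog' (Nat.cast_nonneg n : (0 : ℝ) ≤ n)
  have h4 := mul_le_mul_of_nonneg_left hquot he
  linarith

/-- The moment generating function of `S` exists at `θ` and has logarithm `Λ θ`. -/
def HasCgfAt {Ω : Type*} [MeasurableSpace Ω] (S : Ω → ℝ) (μ : Measure Ω) (Λ : ℝ → ℝ) (θ : ℝ) :
    Prop :=
  Integrable (fun z => Real.exp (θ * S z)) μ ∧ mgf S μ θ = Real.exp (Λ θ)

/-- A finite lower integral of the nonnegative exponential yields integrability and the value of the
generating function at once. -/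
lemma HasCgfAt.of_lintegral {Ω : Type*} [MeasurableSpace Ω] {S : Ω → ℝ} {μ : Measure Ω}
    {Λ : ℝ → ℝ} {θ : ℝ} (hS : Measurable S)
    (h : ∫⁻ z, ENNReal.ofReal (Real.exp (θ * S z)) ∂μ = ENNReal.ofReal (Real.exp (Λ θ))) :
    HasCgfAt S μ Λ θ := by
  constructor
  · refine ⟨by fun_prop, ?_⟩
    rw [hasFiniteIntegral_iff_ofReal (ae_of_all _ fun z => (Real.exp_pos _).le), h]
    exact ENNReal.ofReal_lt_top
  · rw [mgf, integral_eq_lintegral_of_nonneg_ae (ae_of_all _ fun z => (Real.exp_pos _).le)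
      (by fun_prop), h, ENNReal.toReal_ofReal (Real.exp_pos _).le]

lemma hasCgfAt_excessInfo {n : ℕ} {P θ : ℝ} (hP : 0 < P) (hθ : |θ| ≤ 1 / 2) (x : Fin n → ℂ) :
    HasCgfAt (excessInfo P x) (awgnNoise n) (excessCgf n P (normSqSum x)) θ := by
  refine .of_lintegral (by fun_prop) (lintegral_exp_excessInfo hP ?_ x)
  have hb : P / (1 + P) ≤ 1 := by rw [div_le_one (by positivity)]; linarith
  have hb0 : 0 < P / (1 + P) := by positivity
  have := neg_abs_le θ
  nlinarith

lemma hasCgfAt_normSqSum {n : ℕ} {P θ : ℝ} (hP : 0 < P) (hθ : |θ * P| ≤ 1 / 2) :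
    HasCgfAt normSqSum (gaussianVector n P) (fun θ => -(n * Real.log (1 - θ * P))) θ := by
  refine .of_lintegral (by fun_prop) (lintegral_exp_normSqSum hP ?_)
  have := le_abs_self (θ * P)
  linarith

section Tails

variable {Ω : Type*} [MeasurableSpace Ω] {S : Ω → ℝ} {μ : Measure Ω} [IsProbabilityMeasure μ]
  {Λ : ℝ → ℝ}

/-- Lower tail bound by exponential tilting, in terms of the moment generating function only. -/
lemma mgf_sub_le_exp_mul_measure (hS : Measurable S) {t h s s' : ℝ} (ht : 0 ≤ t) (hh : 0 ≤ h)
    (h0 : Integrable (fun z => Real.exp (-t * S z)) μ)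
    (h1 : Integrable (fun z => Real.exp ((-t + h) * S z)) μ)
    (h2 : Integrable (fun z => Real.exp ((-t - h) * S z)) μ) :
    mgf S μ (-t) - Real.exp (-(h * s)) * mgf S μ (-t + h) - Real.exp (h * s') * mgf S μ (-t - h)
      ≤ Real.exp (-(t * s')) * μ.real {z | s' ≤ S z ∧ S z ≤ s} := by
  set A : Set Ω := {z | s' ≤ S z ∧ S z ≤ s} with hA
  have hAm : MeasurableSet A :=
    (measurableSet_le measurable_const hS).inter (measurableSet_le hS measurable_const)
  have hind : Integrable (A.indicator fun _ => Real.exp (-(t * s'))) μ :=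
    (integrable_const _).indicator hAm
  have hI : ∫ z, A.indicator (fun _ => Real.exp (-(t * s'))) z ∂μ
      = Real.exp (-(t * s')) * μ.real A := by
    rw [integral_indicator_const _ hAm, smul_eq_mul, mul_comm]
  have h01 : Integrable (fun z => Real.exp (-t * S z)
      - Real.exp (-(h * s)) * Real.exp ((-t + h) * S z)) μ := h0.sub (h1.const_mul _)
  rw [← hI]
  simp only [mgf]
  rw [← integral_const_mul, ← integral_const_mul, ← integral_sub h0 (h1.const_mul _),
    ← integral_sub h01 (h2.const_mul _)]
  refine integral_mono (h01.sub (h2.const_mul _)) hind fun z => ?_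
  dsimp only
  rw [← Real.exp_add, ← Real.exp_add]
  have p1 := Real.exp_pos (-(h * s) + (-t + h) * S z)
  have p2 := Real.exp_pos (h * s' + (-t - h) * S z)
  -- Outside the window the tilted weight exp(-tS) is dominated by one of the two subtracted terms:
  -- the shift by +h handles S > s, the shift by -h handles S < s'.
  by_cases hz : z ∈ A
  · rw [Set.indicator_of_mem hz]
    have : Real.exp (-t * S z) ≤ Real.exp (-(t * s')) := by
      apply Real.exp_le_exp.2
      nlinarith [hz.1]
    linarith
  · rw [Set.indicator_of_notMem hz]
    by_cases hs : S z ≤ s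
    · have hs' : S z < s' := by
        by_contra hc
        exact hz ⟨not_lt.1 hc, hs⟩
      have : Real.exp (-t * S z) ≤ Real.exp (h * s' + (-t - h) * S z) := by
        apply Real.exp_le_exp.2
        nlinarith
      linarith
    · have : Real.exp (-t * S z) ≤ Real.exp (-(h * s) + (-t + h) * S z) := by
        apply Real.exp_le_exp.2
        nlinarith
      linarith

/-- Moderate-deviation lower bound under a quadratic approximation of the cumulant generating
function. -/
lemma half_exp_le_measure (hS : Measurable S) {t h d m v : ℝ} (ht : 0 ≤ t) (hh : 0 ≤ h)
    (hd : h * d = 5) (hv : v * h ^ 2 ≤ 1)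
    (hΛ : ∀ θ, |θ| ≤ t + h → HasCgfAt S μ Λ θ ∧ |Λ θ - (m * θ + v * θ ^ 2 / 2)| ≤ 1) :
    1 / 2 * Real.exp (-(v * t ^ 2 / 2 + t * d + 1))
      ≤ μ.real {z | m - v * t - d ≤ S z ∧ S z ≤ m - v * t + d} := by
  obtain ⟨⟨i0, m0⟩, b0⟩ := hΛ (-t) (by rw [abs_neg, abs_of_nonneg ht]; linarith)
  obtain ⟨⟨i1, m1⟩, b1⟩ := hΛ (-t + h) (by rw [abs_le]; constructor <;> linarith)
  obtain ⟨⟨i2, m2⟩, b2⟩ := hΛ (-t - h) (by rw [abs_le]; constructor <;> linarith)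
  have key := mgf_sub_le_exp_mul_measure (μ := μ) hS (s := m - v * t + d) (s' := m - v * t - d)
    ht hh i0 i1 i2
  rw [m0, m1, m2, ← Real.exp_add, ← Real.exp_add] at key
  rw [abs_le] at b0 b1 b2
  -- Relative to Λ(-t), the exponent is at most -hd + vh²/2 + 2 ≤ -5/2, the 2 coming from two
  -- approximation errors. Each side thus loses at most a quarter of the tilted mass, which explains
  -- hd = 5 and the factor 1/2.
  have e1 : Real.exp (-(h * (m - v * t + d)) + Λ (-t + h)) ≤ Real.exp (Λ (-t)) * (1 / 4) := by
    have h5 : Real.exp (-(5 / 2)) ≤ 1 / 4 := by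
      rw [Real.exp_neg, inv_le_comm₀ (Real.exp_pos _) (by norm_num)]
      have := Real.quadratic_le_exp_of_nonneg (show (0 : ℝ) ≤ 5 / 2 by norm_num)
      linarith
    refine le_trans ?_ (mul_le_mul_of_nonneg_left h5 (Real.exp_pos _).le)
    rw [← Real.exp_add, Real.exp_le_exp]
    nlinarith
  have e2 : Real.exp (h * (m - v * t - d) + Λ (-t - h)) ≤ Real.exp (Λ (-t)) * (1 / 4) := by
    have h5 : Real.exp (-(5 / 2)) ≤ 1 / 4 := by
      rw [Real.exp_neg, inv_le_comm₀ (Real.exp_pos _) (by norm_num)]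
      have := Real.quadratic_le_exp_of_nonneg (show (0 : ℝ) ≤ 5 / 2 by norm_num)
      linarith
    refine le_trans ?_ (mul_le_mul_of_nonneg_left h5 (Real.exp_pos _).le)
    rw [← Real.exp_add, Real.exp_le_exp]
    nlinarith
  have e3 : Real.exp (-(v * t ^ 2 / 2 + t * d + 1))
      ≤ Real.exp (Λ (-t)) * Real.exp (t * (m - v * t - d)) := by
    rw [← Real.exp_add, Real.exp_le_exp]
    nlinarith
  have e4 : Real.exp (-(t * (m - v * t - d))) * Real.exp (t * (m - v * t - d)) = 1 := by
    rw [← Real.exp_add, neg_add_cancel, Real.exp_zero]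
  calc 1 / 2 * Real.exp (-(v * t ^ 2 / 2 + t * d + 1))
      ≤ (1 / 2 * Real.exp (Λ (-t))) * Real.exp (t * (m - v * t - d)) := by linarith
    _ ≤ (Real.exp (-(t * (m - v * t - d)))
        * μ.real {z | m - v * t - d ≤ S z ∧ S z ≤ m - v * t + d})
        * Real.exp (t * (m - v * t - d)) := by
      refine mul_le_mul_of_nonneg_right ?_ (Real.exp_pos _).le
      linarith
    _ = _ := by
      rw [mul_right_comm, e4, one_mul]

lemma HasCgfAt.measure_ge_le {θ : ℝ} (h : HasCgfAt S μ Λ θ) (hθ : 0 ≤ θ) (s : ℝ) :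
    μ.real {z | s ≤ S z} ≤ Real.exp (-θ * s + Λ θ) := by
  rw [Real.exp_add, ← h.2]
  exact measure_ge_le_exp_mul_mgf s hθ h.1

lemma HasCgfAt.measure_le_le {θ : ℝ} (h : HasCgfAt S μ Λ θ) (hθ : θ ≤ 0) (s : ℝ) :
    μ.real {z | S z ≤ s} ≤ Real.exp (-θ * s + Λ θ) := by
  rw [Real.exp_add, ← h.2]
  exact measure_le_le_exp_mul_mgf s hθ h.1

end Tails

/-! ### The scales √n and √(ln n). -/

lemma tendsto_sqrt_log : Tendsto (fun n : ℕ => √(Real.log n)) atTop atTop :=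
  Real.tendsto_sqrt_atTop.comp (Real.tendsto_log_atTop.comp tendsto_natCast_atTop_atTop)

lemma eventually_le_sqrt_log (C : ℝ) : ∀ᶠ n : ℕ in atTop, C ≤ √(Real.log n) :=
  tendsto_sqrt_log.eventually_ge_atTop C

lemma eventually_le_sqrt (C : ℝ) : ∀ᶠ n : ℕ in atTop, C ≤ √(n : ℝ) :=
  (Real.tendsto_sqrt_atTop.comp tendsto_natCast_atTop_atTop).eventually_ge_atTop C

lemma exp_sqrt_log_sq {n : ℕ} (hn : 1 ≤ n) : Real.exp (√(Real.log n) ^ 2) = n := by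
  have h : (1 : ℝ) ≤ n := by exact_mod_cast hn
  rw [Real.sq_sqrt (Real.log_nonneg h), Real.exp_log (by linarith)]

lemma exp_half_sqrt_log_sq {n : ℕ} (hn : 1 ≤ n) :
    Real.exp (√(Real.log n) ^ 2 / 2) = √(n : ℝ) := by
  rw [Real.exp_half, exp_sqrt_log_sq hn]

/-- With L = √(ln n), √n = exp(L²/2), and this is at least exp L once L ≥ 2; exp L beats every power
of L. -/
lemma eventually_mul_sqrt_log_pow_le (C : ℝ) (k : ℕ) :
    ∀ᶠ n : ℕ in atTop, C * √(Real.log n) ^ k ≤ √(n : ℝ) := by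
  have h : Tendsto (fun n : ℕ => √(Real.log n) ^ k / Real.exp √(Real.log n)) atTop (nhds 0) := by
    have := (Real.tendsto_pow_mul_exp_neg_atTop_nhds_zero k).comp tendsto_sqrt_log
    refine this.congr fun n => ?_
    simp [Real.exp_neg, div_eq_mul_inv]
  have h2 := h.const_mul C
  rw [mul_zero] at h2
  filter_upwards [h2.eventually (eventually_le_nhds zero_lt_one), eventually_le_sqrt_log 2,
    eventually_ge_atTop 1] with n h3 h4 h5
  rw [← exp_half_sqrt_log_sq h5]
  rw [← mul_div_assoc, div_le_one (Real.exp_pos _)] at h3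
  refine h3.trans (Real.exp_le_exp.2 ?_)
  nlinarith

lemma awgnDispersion_pos {P : ℝ} (hP : 0 < P) : 0 < awgnDispersion P := by
  unfold awgnDispersion
  positivity

lemma awgnDispersion_le_one {P : ℝ} (hP : 0 < P) : awgnDispersion P ≤ 1 := by
  unfold awgnDispersion
  rw [div_le_one (by positivity)]
  nlinarith

/-! ### Moderate deviations of the information density, uniformly in the input. -/

/-- Uniform quadratic approximation of the cumulant generating function in the
moderate-deviation range. -/
lemma eventually_excessCgf_approx {P : ℝ} (hP : 0 < P) {B : ℝ} (hB : 0 ≤ B) (C : ℝ) :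
    ∀ᶠ n : ℕ in atTop, ∀ x : Fin n → ℂ, |n * P - normSqSum x| ≤ B * (√n * √(Real.log n)) →
      ∀ θ : ℝ, |θ| ≤ C * √(Real.log n) / √n →
        HasCgfAt (excessInfo P x) (awgnNoise n) (excessCgf n P (normSqSum x)) θ ∧
        |excessCgf n P (normSqSum x) θ
          - (-((n * P - normSqSum x) / (1 + P)) * θ + n * awgnDispersion P * θ ^ 2 / 2)| ≤ 1 := by
  filter_upwards [eventually_le_sqrt_log 1, eventually_le_sqrt 1,
    eventually_mul_sqrt_log_pow_le ((2 + 2 * (P + B)) * C ^ 3 + B * C ^ 2) 3,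
    eventually_mul_sqrt_log_pow_le 1 1,
    eventually_mul_sqrt_log_pow_le (2 * C) 1] with n hL hq h3 h1 hC1 x hx θ hθ
  have hn : (n : ℝ) = √(n : ℝ) ^ 2 := (Real.sq_sqrt (Nat.cast_nonneg n)).symm
  set q : ℝ := √(n : ℝ)
  set L : ℝ := √(Real.log n)
  have hq0 : 0 < q := by linarith
  have hθ2 : |θ| ≤ 1 / 2 := by
    refine hθ.trans ?_
    rw [div_le_iff₀ hq0]
    linarith
  refine ⟨hasCgfAt_excessInfo hP hθ2 x, (abs_excessCgf_sub_le n hP (normSqSum_nonneg x) hθ2).trans ?_⟩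
  have he : normSqSum x ≤ (P + B) * q ^ 2 := by
    have := neg_abs_le ((n : ℝ) * P - normSqSum x)
    have h4 : B * (q * L) ≤ B * (q * q) := by gcongr; linarith
    rw [hn] at this hx
    nlinarith
  calc (2 * n + 2 * normSqSum x) * |θ| ^ 3 + |n * P - normSqSum x| * θ ^ 2
      ≤ (2 * q ^ 2 + 2 * ((P + B) * q ^ 2)) * (C * L / q) ^ 3
        + B * (q * L) * (C * L / q) ^ 2 := by
        rw [← sq_abs θ, ← hn]
        rw [← hn] at he
        gcongr
    _ = ((2 + 2 * (P + B)) * C ^ 3 + B * C ^ 2) * L ^ 3 / q := by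
        field_simp
    _ ≤ 1 := by
        rw [div_le_one hq0]
        exact h3

/-- Moving the threshold by O(√n) from -√V √(n ln n) gains the factor exp √(ln n) over 1/√n. This
gain absorbs the drop of order √(ln n)/√n of the linear bound in `eventually_excessInfo_gt_le`
across its transition window. -/
lemma eventually_lower_tail {P : ℝ} (hP : 0 < P) {B : ℝ} (hB : 0 ≤ B) :
    ∀ᶠ n : ℕ in atTop, ∀ x : Fin n → ℂ, |n * P - normSqSum x| ≤ B * (√n * √(Real.log n)) →
      normSqSum x ≤ n * P + 2 * P * √n →
      1 / 2 * Real.exp √(Real.log n) / √n ≤ (awgnNoise n).real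
        {z | excessInfo P x z ≤ -(√n * (√(awgnDispersion P) * √(Real.log n) - 13))} := by
  have hV := awgnDispersion_pos hP
  have hV1 := awgnDispersion_le_one hP
  have hVs : √(awgnDispersion P) ^ 2 = awgnDispersion P := Real.sq_sqrt hV.le
  have hσ : 0 < √(awgnDispersion P) := Real.sqrt_pos.2 hV
  set V := awgnDispersion P with hVdef
  set σ := √V with hσdef
  have hσ1 : σ ≤ 1 := by nlinarith
  filter_upwards [eventually_le_sqrt_log 1, eventually_le_sqrt_log (6 / σ), eventually_le_sqrt 1,
    eventually_ge_atTop 1,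
    eventually_excessCgf_approx hP hB (1 / σ + 1)]
    with n hL hL6 hq hn1 happ x hx hxe
  have hn : (n : ℝ) = √(n : ℝ) ^ 2 := (Real.sq_sqrt (Nat.cast_nonneg n)).symm
  have hexp := exp_half_sqrt_log_sq hn1
  have happ := happ x hx
  set q : ℝ := √(n : ℝ)
  set L : ℝ := √(Real.log n)
  have hq0 : 0 < q := by linarith
  -- L/σ alone would give exp(-L²/2) = 1/q. Lowering it by 6/V gains 6L/σ in the exponent, against a
  -- window cost of 5τ; the surplus L/σ ≥ L is the factor exp L.
  set τ : ℝ := L / σ - 6 / V with hτ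
  have hVτ : V * τ = σ * L - 6 := by
    rw [hτ, ← hVs]
    field_simp
  have hτ0 : 0 ≤ τ := by
    have : 0 ≤ V * τ := by
      rw [hVτ]
      rw [div_le_iff₀ hσ] at hL6
      linarith
    exact nonneg_of_mul_nonneg_right this hV
  have hmain := half_exp_le_measure (μ := awgnNoise n) (S := excessInfo P x)
    (Λ := excessCgf n P (normSqSum x)) (by fun_prop) (t := τ / q) (h := 1 / q) (d := 5 * q)
    (m := -((n * P - normSqSum x) / (1 + P))) (v := n * V) (by positivity) (by positivity)
    (by field_simp) (by rw [hn]; field_simp; exact hV1) (fun θ hθ => happ θ (hθ.trans (by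
      rw [← add_div]
      have : τ ≤ L / σ := by
        have : 0 < 6 / V := by positivity
        linarith
      have h2 : L / σ = 1 / σ * L := by ring
      gcongr
      nlinarith)))
  have e1 : n * V * (τ / q) ^ 2 / 2 + τ / q * (5 * q) + 1 = V * τ ^ 2 / 2 + 5 * τ + 1 := by
    rw [hn]
    field_simp
  have e2 : V * τ ^ 2 / 2 + 5 * τ + 1 ≤ L ^ 2 / 2 - L := by
    have h1 : V * τ ^ 2 / 2 = L ^ 2 / 2 - 6 * L / σ + 18 / V := by
      rw [hτ, ← hVs]
      field_simp
      ring
    have h2 : L ≤ L / σ := by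
      rw [le_div_iff₀ hσ]
      nlinarith
    have h3 : 1 ≤ 1 / V := by rwa [le_div_iff₀ hV, one_mul]
    have h4 : 6 * L / σ = 6 * (L / σ) := by ring
    have h5 : 18 / V = 18 * (1 / V) := by ring
    have h6 : 6 / V = 6 * (1 / V) := by ring
    rw [h1, hτ, h4, h5, h6]
    linarith
  have e3 : 1 / 2 * Real.exp L / q
      ≤ 1 / 2 * Real.exp (-(n * V * (τ / q) ^ 2 / 2 + τ / q * (5 * q) + 1)) := by
    rw [e1, mul_div_assoc]
    gcongr
    rw [← hexp, ← Real.exp_sub, Real.exp_le_exp]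
    linarith
  refine e3.trans (hmain.trans (measureReal_mono fun z hz => ?_))
  have hz2 : excessInfo P x z ≤ -((n * P - normSqSum x) / (1 + P)) - n * V * (τ / q) + 5 * q :=
    hz.2
  have h1 : n * V * (τ / q) = q * (σ * L - 6) := by
    rw [← hVτ, hn]
    field_simp
  have h2 : -((n * P - normSqSum x) / (1 + P)) ≤ 2 * q := by
    rw [← neg_div, div_le_iff₀ (by positivity)]
    nlinarith
  -- 13 = 6 + 5 + 2: the reduction in τ, the half-width of the window, and the shift of the mean
  -- when the energy exceeds nP by at most 2Pq.
  rw [h1] at hz2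
  change excessInfo P x z ≤ -(q * (σ * L - 13))
  nlinarith

/-- An energy deficit of order √(n ln n) pushes the mean far below the threshold, and Chernoff at θ
= L/q suffices. The deficit contributes -(P + 6)L²: the part P cancels the error Rθ², and 6 pays for
the other terms and leaves exp(-L²) = 1/n. -/
lemma eventually_upper_tail {P : ℝ} (hP : 0 < P) :
    ∀ᶠ n : ℕ in atTop, ∀ x : Fin n → ℂ,
      (P + 6) * (1 + P) * (√n * √(Real.log n)) ≤ n * P - normSqSum x →
      (awgnNoise n).real
        {z | -(√n * (√(awgnDispersion P) * √(Real.log n) - 13)) ≤ excessInfo P x z} ≤ 1 / n := by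
  have hV := awgnDispersion_pos hP
  have hV1 := awgnDispersion_le_one hP
  have hσ1 : √(awgnDispersion P) ≤ 1 := Real.sqrt_le_one.2 hV1
  set V := awgnDispersion P with hVdef
  set σ := √V with hσdef
  filter_upwards [eventually_le_sqrt_log 1, eventually_le_sqrt 1,
    eventually_ge_atTop 1, eventually_mul_sqrt_log_pow_le (2 + 2 * P) 3,
    eventually_mul_sqrt_log_pow_le 2 1] with n hL hq hn1 h3 h1 x hx
  have hn : (n : ℝ) = √(n : ℝ) ^ 2 := (Real.sq_sqrt (Nat.cast_nonneg n)).symm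
  have hexp := exp_sqrt_log_sq hn1
  have he0 := normSqSum_nonneg x
  have hcgf (θ : ℝ) (hθ : |θ| ≤ 1 / 2) := abs_excessCgf_sub_le n hP he0 hθ
  set q : ℝ := √(n : ℝ)
  set L : ℝ := √(Real.log n)
  have hq0 : 0 < q := by linarith
  set R : ℝ := n * P - normSqSum x with hR
  have hRP : R ≤ n * P := by linarith
  have hR0 : 0 ≤ R := le_trans (by positivity) hx
  have hθ0 : 0 ≤ L / q := by positivity
  have hθ : |L / q| ≤ 1 / 2 := by
    rw [abs_of_nonneg hθ0, div_le_iff₀ hq0]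
    linarith
  refine ((hasCgfAt_excessInfo hP hθ x).measure_ge_le hθ0 _).trans ?_
  rw [one_div, ← hexp, ← Real.exp_neg, Real.exp_le_exp]
  have hc := (abs_le.1 (hcgf _ hθ)).2
  rw [abs_of_nonneg hR0, abs_of_nonneg hθ0] at hc
  have c1 : (2 * n + 2 * normSqSum x) * (L / q) ^ 3 ≤ 1 := by
    calc (2 * n + 2 * normSqSum x) * (L / q) ^ 3
        ≤ (2 * q ^ 2 + 2 * (q ^ 2 * P)) * (L / q) ^ 3 := by
          rw [← hn]
          gcongr
          linarith
      _ = (2 + 2 * P) * L ^ 3 / q := by field_simp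
      _ ≤ 1 := by
          rw [div_le_one hq0]
          exact h3
  have c2 : R * (L / q) ^ 2 ≤ P * L ^ 2 := by
    calc R * (L / q) ^ 2 ≤ (q ^ 2 * P) * (L / q) ^ 2 := by
          rw [← hn]
          gcongr
      _ = P * L ^ 2 := by field_simp
  have c3 : n * V * (L / q) ^ 2 / 2 ≤ L ^ 2 / 2 := by
    have : n * V * (L / q) ^ 2 / 2 = V * L ^ 2 / 2 := by
      rw [hn]
      field_simp
    rw [this]
    nlinarith [sq_nonneg L]
  have c4 : -(R / (1 + P)) * (L / q) ≤ -((P + 6) * L ^ 2) := by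
    have : (P + 6) * (q * L) ≤ R / (1 + P) := by
      rw [le_div_iff₀ (by positivity)]
      linarith
    have h5 := mul_le_mul_of_nonneg_right this hθ0
    have h6 : (P + 6) * (q * L) * (L / q) = (P + 6) * L ^ 2 := by field_simp
    linarith
  have c5 : -(L / q) * -(q * (σ * L - 13)) ≤ L ^ 2 := by
    have : -(L / q) * -(q * (σ * L - 13)) = σ * L ^ 2 - 13 * L := by
      field_simp
    rw [this]
    nlinarith [sq_nonneg L]
  nlinarith

/-- Above the second-order threshold, the probability of a large information density is dominated
by a linear function of the codeword energy. -/
lemma eventually_excessInfo_gt_le {P : ℝ} (hP : 0 < P) :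
    ∀ᶠ n : ℕ in atTop, ∀ x : Fin n → ℂ, (awgnNoise n).real
        {z | -(√n * (√(awgnDispersion P) * √(Real.log n) - 13)) < excessInfo P x z}
      ≤ (1 - 1 / √n) * (normSqSum x / (n * P)) + 1 / n := by
  set B : ℝ := (P + 6) * (1 + P) with hBdef
  have hB : 0 < B := by positivity
  have hgrow : ∀ᶠ n : ℕ in atTop, 2 * (1 + B / P * √(Real.log n)) ≤ Real.exp √(Real.log n) := by
    filter_upwards [eventually_le_sqrt_log (4 * (1 + B / P)), eventually_le_sqrt_log 1]
      with n h1 h2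
    have h3 := Real.quadratic_le_exp_of_nonneg (Real.sqrt_nonneg (Real.log n))
    have h4 : 0 < B / P := by positivity
    nlinarith
  filter_upwards [eventually_lower_tail hP hB.le, eventually_upper_tail hP, hgrow,
    eventually_le_sqrt_log 1, eventually_le_sqrt 2] with n hlow hup hgr hL hq x
  have hn : (n : ℝ) = √(n : ℝ) ^ 2 := (Real.sq_sqrt (Nat.cast_nonneg n)).symm
  have he0 := normSqSum_nonneg x
  have hlow := hlow x
  have hup := hup x
  set q : ℝ := √(n : ℝ)
  set L : ℝ := √(Real.log n)
  have hq0 : 0 < q := by linarith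
  have hn0 : (0 : ℝ) < n := by rw [hn]; positivity
  have hqi : 1 / q ≤ 1 / 2 := by gcongr
  have hratio : 0 ≤ normSqSum x / (n * P) := by positivity
  -- Three energy ranges: above nP + 2Pq the line itself reaches 1; below nP - BqL the probability
  -- is at most 1/n; in between, the lower tail pushes the probability under the line.
  by_cases h1 : n * P + 2 * P * q ≤ normSqSum x
  · have h2 : 1 + 2 / q ≤ normSqSum x / (n * P) := by
      rw [le_div_iff₀ (by positivity)]
      refine le_trans (le_of_eq ?_) h1
      rw [hn]
      field_simp
    refine measureReal_le_one.trans ?_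
    have h3 : (1 - 1 / q) * (1 + 2 / q) ≤ (1 - 1 / q) * (normSqSum x / (n * P)) := by
      apply mul_le_mul_of_nonneg_left h2
      linarith
    have h4 : (1 - 1 / q) * (1 + 2 / q) = 1 + 1 / q * (1 - 2 * (1 / q)) := by ring
    have h5 : 0 ≤ 1 / q * (1 - 2 * (1 / q)) := mul_nonneg (by positivity) (by linarith)
    have : 0 < 1 / (n : ℝ) := by positivity
    linarith
  · push Not at h1
    by_cases h2 : B * (q * L) ≤ n * P - normSqSum x
    · have h3 := hup h2
      have hsub : {z | -(q * (√(awgnDispersion P) * L - 13)) < excessInfo P x z}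
          ⊆ {z | -(q * (√(awgnDispersion P) * L - 13)) ≤ excessInfo P x z} :=
        Set.ofPred_subset_ofPred.2 fun z hz => hz.le
      refine (measureReal_mono hsub).trans (h3.trans ?_)
      have : 0 ≤ (1 - 1 / q) * (normSqSum x / (n * P)) := mul_nonneg (by linarith) hratio
      linarith
    · push Not at h2
      have h3 : |n * P - normSqSum x| ≤ B * (q * L) := by
        rw [abs_le]
        refine ⟨?_, h2.le⟩
        have : 2 * P * q ≤ B * (q * L) := by
          have : 2 * P ≤ B * L := by nlinarith
          nlinarith
        linarith
      have h4 := hlow h3 h1.le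
      have hcompl : (awgnNoise n).real {z | -(q * (√(awgnDispersion P) * L - 13))
            < excessInfo P x z}
          = 1 - (awgnNoise n).real {z | excessInfo P x z
            ≤ -(q * (√(awgnDispersion P) * L - 13))} := by
        rw [← probReal_compl_eq_one_sub (measurableSet_le (by fun_prop) measurable_const)]
        congr 1
        ext z
        simp
      rw [hcompl]
      have h5 : 1 - B / P * L / q ≤ normSqSum x / (n * P) := by
        rw [le_div_iff₀ (by positivity)]
        have : (1 - B / P * L / q) * (n * P) = n * P - B * (q * L) := by
          rw [hn]
          field_simp
        linarith
      have h6 : (1 - 1 / q) * (1 - B / P * L / q) ≤ (1 - 1 / q) * (normSqSum x / (n * P)) := by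
        apply mul_le_mul_of_nonneg_left h5
        linarith
      have h7 : (1 + B / P * L) / q ≤ 1 / 2 * Real.exp L / q := by
        gcongr
        linarith
      have h8 : (1 - 1 / q) * (1 - B / P * L / q)
          = 1 - (1 + B / P * L) / q + (B / P * L) / q * (1 / q) := by ring
      have h9 : 0 ≤ (B / P * L) / q * (1 / q) := by positivity
      have : 0 < 1 / (n : ℝ) := by positivity
      linarith

/-! ### Converse. -/

namespace ChannelCode

variable {n M : ℕ}

lemma one_le_card (c : ChannelCode n M) : 1 ≤ M := by
  have := (c.dec 0).isLt
  omega

lemma energy_nonneg (c : ChannelCode n M) (j : Fin M) : 0 ≤ c.energy j :=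
  normSqSum_nonneg _

lemma ShortTermPower.longTermPower {c : ChannelCode n M} {ρ : ℝ} (h : c.ShortTermPower ρ) :
    c.LongTermPower ρ := by
  have hM : (0 : ℝ) < M := by exact_mod_cast c.one_le_card
  have h1 : ∑ j, c.energy j ≤ M * (n * ρ) := by
    simpa using Finset.sum_le_sum fun j (_ : j ∈ Finset.univ) => h j
  rw [LongTermPower, one_div, inv_mul_le_iff₀ hM]
  exact h1

/-- The meta-converse bound with a Gaussian output law. -/
lemma card_mul_one_sub_avgError_le (c : ChannelCode n M) {P : ℝ} (hP : 0 < P) (g : ℝ) :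
    M * (1 - c.avgError) ≤ ∑ j, (awgnNoise n).real {z | g < excessInfo P (c.enc j) z}
      + (1 + P) ^ n * Real.exp g := by
  have := isProbabilityMeasure_gaussianVector n (show 0 < 1 + P by positivity)
  have hM : (0 : ℝ) < M := by exact_mod_cast c.one_le_card
  have hD (j : Fin M) : MeasurableSet (c.dec ⁻¹' {j}) := c.measurable_dec (measurableSet_singleton j)
  have hj (j : Fin M) : 1 - (awgnNoise n).real {z | c.dec (c.enc j + z) ≠ j}
      ≤ (awgnNoise n).real {z | g < excessInfo P (c.enc j) z}
        + (1 + P) ^ n * Real.exp g * (gaussianVector n (1 + P)).real (c.dec ⁻¹' {j}) := by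
    have h := awgnNoise_shift_le hP (c.enc j) g (hD j)
    have h2 := ENNReal.toReal_mono (by finiteness) h
    rw [ENNReal.toReal_add (by finiteness) (by finiteness), ENNReal.toReal_mul,
      ENNReal.toReal_ofReal (by positivity)] at h2
    refine le_trans (le_of_eq ?_) h2
    rw [← probReal_compl_eq_one_sub]
    · change _ = (awgnNoise n).real _
      congr 1
      ext z
      simp
    · exact (measurableSet_shift (c.enc j) (hD j)).compl
  have hsum : ∑ j, (gaussianVector n (1 + P)).real (c.dec ⁻¹' {j}) = 1 := by
    rw [sum_measureReal_preimage_singleton _ fun j _ => hD j]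
    simp
  have key := Finset.sum_le_sum fun j (_ : j ∈ Finset.univ) => hj j
  rw [Finset.sum_add_distrib, ← Finset.mul_sum, hsum, mul_one, Finset.sum_sub_distrib] at key
  refine le_trans (le_of_eq ?_) key
  rw [avgError]
  field_simp
  simp

end ChannelCode

lemma excessCgf_half_le {n : ℕ} {e : ℝ} (he : 0 ≤ e) : excessCgf n 1 e (1 / 2) ≤ e := by
  unfold excessCgf
  have : 0 ≤ (n : ℝ) * Real.log (1 + 1 / 2 * (1 / (1 + 1))) :=
    mul_nonneg (Nat.cast_nonneg n) (Real.log_nonneg (by norm_num))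
  norm_num at this ⊢
  linarith

/-- The converse argument in crude form. Only finiteness matters, so P = 1 serves as reference;
codewords of energy above E are handled by e/E ≥ 1, the others by Chernoff at θ = 1/2. Each
contribution to the sum is at most M(1-ε)/4, leaving half of M(1-ε). -/
lemma bddAbove_longTermRates {ρ ε : ℝ} (hρ : 0 < ρ) (hε : ε < 1) {n : ℕ} (hn : 1 ≤ n) :
    BddAbove (longTermRates ρ n ε) := by
  have hn0 : (0 : ℝ) < n := by exact_mod_cast hn
  have hε' : 0 < 1 - ε := sub_pos.2 hε
  set E : ℝ := 4 * (n * ρ) / (1 - ε) with hE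
  have hE0 : 0 < E := by positivity
  set g : ℝ := 2 * (E + Real.log (4 / (1 - ε))) with hg
  set B : ℝ := (1 + 1) ^ n * Real.exp g * 2 / (1 - ε) with hB
  refine ⟨Real.log B / n, ?_⟩
  rintro r ⟨M, c, hpow, herr, rfl⟩
  have hM : (0 : ℝ) < M := by exact_mod_cast c.one_le_card
  have hf (j : Fin M) : (awgnNoise n).real {z | g < excessInfo 1 (c.enc j) z}
      ≤ c.energy j / E + (1 - ε) / 4 := by
    by_cases h : c.energy j ≤ E
    · have hc := hasCgfAt_excessInfo (n := n) (P := 1) (θ := 1 / 2) one_pos (by norm_num) (c.enc j)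
      have hsub : {z | g < excessInfo 1 (c.enc j) z} ⊆ {z | g ≤ excessInfo 1 (c.enc j) z} :=
        Set.ofPred_subset_ofPred.2 fun z hz => hz.le
      refine (measureReal_mono hsub).trans ((hc.measure_ge_le (by norm_num) g).trans ?_)
      have h1 : -(1 / 2) * g + excessCgf n 1 (normSqSum (c.enc j)) (1 / 2)
          ≤ -Real.log (4 / (1 - ε)) := by
        have h2 := excessCgf_half_le (n := n) (normSqSum_nonneg (c.enc j))
        have h3 : normSqSum (c.enc j) ≤ E := h
        rw [hg]
        linarith
      have h4 : Real.exp (-Real.log (4 / (1 - ε))) = (1 - ε) / 4 := by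
        rw [Real.exp_neg, Real.exp_log (by positivity), inv_div]
      have h5 : 0 ≤ c.energy j / E := div_nonneg (c.energy_nonneg j) hE0.le
      have h6 := Real.exp_le_exp.2 h1
      linarith
    · refine measureReal_le_one.trans ?_
      have h1 : 1 ≤ c.energy j / E := by
        rw [le_div_iff₀ hE0]
        linarith
      linarith
  have key := c.card_mul_one_sub_avgError_le one_pos g
  have hsum := Finset.sum_le_sum fun j (_ : j ∈ Finset.univ) => hf j
  rw [Finset.sum_add_distrib, ← Finset.sum_div] at hsum
  simp only [Finset.sum_const, Finset.card_univ, Fintype.card_fin, nsmul_eq_mul] at hsum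
  rw [ChannelCode.LongTermPower, one_div, inv_mul_le_iff₀ hM] at hpow
  have h1 : (∑ j, c.energy j) / E ≤ M * (1 - ε) / 4 := by
    rw [div_le_iff₀ hE0, hE]
    refine hpow.trans (le_of_eq ?_)
    field_simp
  have h2 : (M : ℝ) * (1 - ε) ≤ M * (1 - c.avgError) := by gcongr
  have h3 : (M : ℝ) ≤ B := by
    rw [hB, le_div_iff₀ hε']
    linarith
  gcongr

/-- Finite-blocklength converse: no code beats the second-order expansion by more than `14/√n`. -/
lemma eventually_log_card_le {P ε : ℝ} (hP : 0 < P) (hε : ε < 1) :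
    ∀ᶠ n : ℕ in atTop, ∀ (M : ℕ) (c : ChannelCode n M) (ρ' ε' : ℝ), ε' ≤ ε →
      ρ' ≤ P * (1 - ε') → c.LongTermPower ρ' → c.avgError ≤ ε' →
      Real.log M / n ≤ awgnCapacity P - √(awgnDispersion P) * √(Real.log n / n) + 14 * (1 / √n) := by
  filter_upwards [eventually_excessInfo_gt_le hP, eventually_ge_atTop 1,
    eventually_mul_sqrt_log_pow_le 1 2, eventually_le_sqrt 1, eventually_le_sqrt (2 / (1 - ε))]
    with n hf hn1 hL hq hqε M c ρ' ε' hεε hρ hpow herr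
  have hε1 : 0 < 1 - ε := sub_pos.2 hε
  have hM : (0 : ℝ) < M := by exact_mod_cast c.one_le_card
  have hn : (n : ℝ) = √(n : ℝ) ^ 2 := (Real.sq_sqrt (Nat.cast_nonneg n)).symm
  have hlogn : Real.log n = √(Real.log n) ^ 2 :=
    (Real.sq_sqrt (Real.log_nonneg (by exact_mod_cast hn1))).symm
  have key := c.card_mul_one_sub_avgError_le hP
    (-(√n * (√(awgnDispersion P) * √(Real.log n) - 13)))
  have hsum := Finset.sum_le_sum fun j (_ : j ∈ Finset.univ) => hf (c.enc j)
  rw [Real.sqrt_div (Real.log_nonneg (by exact_mod_cast hn1))]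
  set q : ℝ := √(n : ℝ)
  set L : ℝ := √(Real.log n)
  set σ : ℝ := √(awgnDispersion P)
  have hq0 : 0 < q := by linarith
  have hn0 : (0 : ℝ) < n := by rw [hn]; positivity
  rw [Finset.sum_add_distrib, ← Finset.mul_sum, ← Finset.sum_div] at hsum
  simp only [Finset.sum_const, Finset.card_univ, Fintype.card_fin, nsmul_eq_mul] at hsum
  rw [ChannelCode.LongTermPower, one_div, inv_mul_le_iff₀ hM] at hpow
  have hq1 : 0 ≤ 1 - 1 / q := by
    rw [sub_nonneg, div_le_one hq0]
    exact hq
  have h1 : (∑ j, normSqSum (c.enc j)) / (n * P) ≤ M * (1 - ε') := by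
    rw [div_le_iff₀ (by positivity)]
    refine hpow.trans ?_
    calc M * (n * ρ') ≤ M * (n * (P * (1 - ε'))) := by gcongr
      _ = _ := by ring
  have h2 := mul_le_mul_of_nonneg_left h1 hq1
  have h3 : (M : ℝ) * (1 - ε') ≤ M * (1 - c.avgError) := by gcongr
  -- The slope 1 - 1/q leaves the slack (1-ε')/q; for q ≥ 2/(1-ε) it exceeds the additive term by at
  -- least 1/n.
  have h4 : (1 / n : ℝ) ≤ (1 - ε') / q - 1 / n := by
    have : 2 * (1 / n : ℝ) ≤ (1 - ε) / q := by
      rw [le_div_iff₀ hq0, hn]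
      rw [div_le_iff₀ hε1] at hqε
      have : 2 * (1 / q ^ 2) * q = 2 / q := by field_simp
      rw [this, div_le_iff₀ hq0]
      linarith
    have h5 : (1 - ε) / q ≤ (1 - ε') / q := by gcongr
    linarith
  have h5 : (M : ℝ) * (1 / n) ≤ (1 + P) ^ n * Real.exp (-(q * (σ * L - 13))) := by
    have := mul_le_mul_of_nonneg_left h4 hM.le
    have e : (M : ℝ) * ((1 - ε') / q - 1 / n)
        = M * (1 - ε') - ((1 - 1 / q) * (M * (1 - ε')) + M * (1 / n)) := by ring
    linarith
  have h6 : (M : ℝ) ≤ n * ((1 + P) ^ n * Real.exp (-(q * (σ * L - 13)))) := by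
    rw [mul_one_div, div_le_iff₀ hn0] at h5
    linarith
  have h7 := Real.log_le_log hM h6
  rw [Real.log_mul (by positivity) (by positivity), Real.log_mul (by positivity) (by positivity),
    Real.log_pow, Real.log_exp, hlogn] at h7
  rw [div_le_iff₀ hn0, awgnCapacity]
  have e : (Real.log (1 + P) - σ * (L / q) + 14 * (1 / q)) * n
      = n * Real.log (1 + P) - q * (σ * L) + 14 * q := by
    rw [hn]
    field_simp
  rw [e]
  -- The constant 14 is the 13 of the threshold plus 1 for ln n ≤ q.
  linarith

/-! ### Achievability with short-term codes. -/

/-- Feinstein's maximal code construction: as long as the decoding regions of the chosen codewords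
do not exhaust the output law, another codeword can be added. -/
lemma exists_codewords_of_card_mul_lt {X Y : Type*} [MeasurableSpace X] [MeasurableSpace Y]
    (W : X → Measure Y) [∀ x, IsProbabilityMeasure (W x)] (G : Measure X) (Q : Measure Y)
    {A : Set X} (hA : MeasurableSet A) {T : X → Set Y} (hT : ∀ x, MeasurableSet (T x))
    {κ : ENNReal} {β δ : ℝ} (hβ : ∀ x ∈ A, (W x).real (T x)ᶜ ≤ β) (hκ : ∀ x, Q (T x) ≤ κ)
    (hQ : ∀ U, MeasurableSet U → ∫⁻ x in A, W x U ∂G ≤ Q U) (k : ℕ)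
    (hk : k * κ < ENNReal.ofReal (δ - β) * G A) :
    ∃ (x : Fin k → X) (D : Fin k → Set Y), (∀ j, x j ∈ A) ∧ (∀ j, MeasurableSet (D j)) ∧
      (∀ i j, i ≠ j → Disjoint (D i) (D j)) ∧ (∀ j, D j ⊆ T (x j)) ∧
      ∀ j, (W (x j)).real (D j)ᶜ ≤ δ := by
  induction k with
  | zero => exact ⟨Fin.elim0, Fin.elim0, fun j => j.elim0, fun j => j.elim0, fun j => j.elim0,
      fun j => j.elim0, fun j => j.elim0⟩
  | succ k ih =>
    have hk' : (k : ENNReal) * κ < ENNReal.ofReal (δ - β) * G A := by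
      refine lt_of_le_of_lt ?_ hk
      gcongr
      exact Nat.le_succ k
    obtain ⟨x, D, hxA, hD, hdisj, hDT, herr⟩ := ih hk'
    set U : Set Y := ⋃ j, D j with hU
    have hUm : MeasurableSet U := MeasurableSet.iUnion hD
    -- If no input can be added, every x in A sends mass at least δ - β into U, so Q U ≥ (δ - β) G
    -- A; but U is covered by k regions of Q-mass at most κ each.
    obtain ⟨x', hx', herr'⟩ : ∃ x' ∈ A, (W x').real (T x' \ U)ᶜ ≤ δ := by
      by_contra! hcon
      have hW (y : X) (hy : y ∈ A) : ENNReal.ofReal (δ - β) ≤ W y U := by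
        refine ENNReal.ofReal_le_of_le_toReal ?_
        have h1 := hcon y hy
        have h2 : (T y \ U)ᶜ = (T y)ᶜ ∪ U := by
          ext z
          simp only [Set.mem_compl_iff, Set.mem_sdiff, Set.mem_union]
          tauto
        rw [h2] at h1
        have h3 := measureReal_union_le (μ := W y) (T y)ᶜ U
        have h4 := hβ y hy
        change δ - β ≤ (W y).real U
        linarith
      have h1 : ENNReal.ofReal (δ - β) * G A ≤ Q U := by
        rw [← setLIntegral_const]
        exact (setLIntegral_mono' hA hW).trans (hQ U hUm)
      have h2 : Q U ≤ k * κ := by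
        refine (measure_iUnion_fintype_le Q D).trans ?_
        refine (Finset.sum_le_sum fun j _ => (measure_mono (hDT j)).trans (hκ (x j))).trans ?_
        simp
      exact absurd hk' (not_lt.2 (h1.trans h2))
    refine ⟨Fin.snoc x x', Fin.snoc (α := fun _ => Set Y) D (T x' \ U), ?_, ?_, ?_, ?_, ?_⟩
    · intro j
      refine Fin.lastCases ?_ (fun i => ?_) j <;> simp [hx', hxA]
    · intro j
      refine Fin.lastCases ?_ (fun i => ?_) j
      · simpa using (hT x').diff hUm
      · simpa using hD i
    · have hd (i : Fin k) : Disjoint (D i) (T x' \ U) :=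
        Set.disjoint_left.2 fun y hy hy' => hy'.2 (Set.mem_iUnion.2 ⟨i, hy⟩)
      intro i j
      refine Fin.lastCases ?_ (fun i => ?_) i <;> refine Fin.lastCases ?_ (fun j => ?_) j
      · simp
      · intro _
        simpa using (hd j).symm
      · intro _
        simpa using hd i
      · intro hij
        simpa using hdisj i j fun h => hij (by rw [h])
    · intro j
      refine Fin.lastCases ?_ (fun i => ?_) j
      · simp
      · simpa using hDT i
    · intro j
      refine Fin.lastCases ?_ (fun i => ?_) j
      · simpa using herr'
      · simpa using herr i

/-- Disjoint measurable decoding regions come from a measurable decoder. -/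
lemma exists_measurable_decoder {Y : Type*} [MeasurableSpace Y] {k : ℕ} (hk : 0 < k)
    {D : Fin k → Set Y} (hD : ∀ j, MeasurableSet (D j))
    (hdisj : ∀ i j, i ≠ j → Disjoint (D i) (D j)) :
    ∃ g : Y → Fin k, Measurable g ∧ ∀ j, ∀ y ∈ D j, g y = j := by
  classical
  set g : Y → Fin k := fun y => if h : ∃ j, y ∈ D j then h.choose else ⟨0, hk⟩ with hg
  have hgD (j : Fin k) (y : Y) (hy : y ∈ D j) : g y = j := by
    have h : ∃ j, y ∈ D j := ⟨j, hy⟩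
    have h1 : g y = h.choose := by simp [hg, h]
    rw [h1]
    by_contra hne
    exact Set.disjoint_left.1 (hdisj _ _ hne) h.choose_spec hy
  refine ⟨g, measurable_to_countable' fun j => ?_, hgD⟩
  have : g ⁻¹' {j} = D j ∪ ((⋃ i, D i)ᶜ ∩ {_y | (⟨0, hk⟩ : Fin k) = j}) := by
    ext y
    simp only [Set.mem_preimage, Set.mem_singleton_iff, Set.mem_union, Set.mem_inter_iff,
      Set.mem_compl_iff, Set.mem_iUnion, Set.mem_ofPred_eq]
    by_cases h : ∃ i, y ∈ D i
    · obtain ⟨i, hi⟩ := h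
      rw [hgD i y hi]
      constructor
      · rintro rfl
        exact Or.inl hi
      · rintro (hj | ⟨hj, _⟩)
        · rw [← hgD i y hi, hgD j y hj]
        · exact absurd ⟨i, hi⟩ hj
    · have h1 : g y = ⟨0, hk⟩ := by simp [hg, h]
      rw [h1]
      constructor
      · exact fun h2 => Or.inr ⟨h, h2⟩
      · rintro (hj | ⟨_, h2⟩)
        · exact absurd ⟨j, hj⟩ h
        · exact h2
  rw [this]
  exact (hD j).union ((MeasurableSet.iUnion hD).compl.inter (MeasurableSet.const _))

/-- A shell of width `O(√n)` inside the power constraint carries a constant fraction of the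
Gaussian input law. -/
lemma eventually_le_gaussianVector_shell {P : ℝ} (hP : 0 < P) :
    ∀ᶠ n : ℕ in atTop, ENNReal.ofReal (1 / 2 * Real.exp (-(121 / 2))) ≤ gaussianVector n P
      {x | n * P - 12 * P * √n ≤ normSqSum x ∧ normSqSum x ≤ n * P - 2 * P * √n} := by
  filter_upwards [eventually_le_sqrt 1024] with n hq
  have := isProbabilityMeasure_gaussianVector n hP
  have hn : (n : ℝ) = √(n : ℝ) ^ 2 := (Real.sq_sqrt (Nat.cast_nonneg n)).symm
  set q : ℝ := √(n : ℝ)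
  have hq0 : 0 < q := by linarith
  -- The tilt t = 7/(Pq) centres the window at nP - 7Pq, and its half-width 5Pq gives the shell. The
  -- exponent is 49/2 + 35 + 1 = 121/2.
  have hmain := half_exp_le_measure (μ := gaussianVector n P) (S := normSqSum)
    (Λ := fun θ => -(n * Real.log (1 - θ * P))) (by fun_prop) (t := 7 / (P * q))
    (h := 1 / (P * q)) (d := 5 * (P * q)) (m := n * P) (v := n * P ^ 2) (by positivity)
    (by positivity) (by field_simp) (by rw [hn]; field_simp; exact le_rfl) (fun θ hθ => by
      have hθP : |θ * P| ≤ 8 / q := by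
        rw [abs_mul, abs_of_pos hP]
        calc |θ| * P ≤ (7 / (P * q) + 1 / (P * q)) * P := by gcongr
          _ = 8 / q := by
            field_simp
            norm_num
      have hθ2 : |θ * P| ≤ 1 / 2 := by
        refine hθP.trans ?_
        rw [div_le_iff₀ hq0]
        linarith
      refine ⟨hasCgfAt_normSqSum hP hθ2, ?_⟩
      have h1 := abs_log_one_sub_add_le hθ2
      have h2 : -(n * Real.log (1 - θ * P)) - (n * P * θ + n * P ^ 2 * θ ^ 2 / 2)
          = -(n * (θ * P + (θ * P) ^ 2 / 2 + Real.log (1 - θ * P))) := by ring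
      rw [h2, abs_neg, abs_mul, abs_of_nonneg (Nat.cast_nonneg n : (0 : ℝ) ≤ n)]
      calc n * |θ * P + (θ * P) ^ 2 / 2 + Real.log (1 - θ * P)|
          ≤ n * (2 * (8 / q) ^ 3) := by
            gcongr
            exact h1.trans (by gcongr)
        _ = 1024 / q := by
            rw [hn]
            field_simp
            norm_num
        _ ≤ 1 := by
            rw [div_le_one hq0]
            exact hq)
  have e1 : n * P ^ 2 * (7 / (P * q)) ^ 2 / 2 + 7 / (P * q) * (5 * (P * q)) + 1 = 121 / 2 := by
    rw [hn]
    field_simp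
    norm_num
  have e2 : n * P ^ 2 * (7 / (P * q)) = 7 * P * q := by
    rw [hn]
    field_simp
  rw [e1, e2] at hmain
  refine ENNReal.ofReal_le_of_le_toReal (hmain.trans (le_of_eq ?_))
  rw [measureReal_def]
  congr 4
  ext x
  constructor <;> rintro ⟨h1, h2⟩ <;> constructor <;> linarith

/-- On the shell, the information density is rarely below the second-order threshold. -/
lemma eventually_excessInfo_le_measure_le {P : ℝ} (hP : 0 < P) :
    ∀ᶠ n : ℕ in atTop, ∀ x : Fin n → ℂ, n * P - 12 * P * √n ≤ normSqSum x →
      normSqSum x ≤ n * P → (awgnNoise n).real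
        {z | excessInfo P x z ≤ -(√n * (√(awgnDispersion P) * √(Real.log n) + 14))}
      ≤ 1 / (√n * √(Real.log n)) / 2 := by
  have hV := awgnDispersion_pos hP
  have hV1 := awgnDispersion_le_one hP
  have hVs : √(awgnDispersion P) ^ 2 = awgnDispersion P := Real.sq_sqrt hV.le
  have hσ : 0 < √(awgnDispersion P) := Real.sqrt_pos.2 hV
  set V := awgnDispersion P with hVdef
  set σ := √V with hσdef
  have hσ1 : σ ≤ 1 := by nlinarith
  filter_upwards [eventually_le_sqrt_log 1, eventually_le_sqrt 1, eventually_ge_atTop 1,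
    eventually_excessCgf_approx hP (B := 12 * P) (by positivity) (1 / σ)]
    with n hL hq hn1 happ x hx hx'
  have hn : (n : ℝ) = √(n : ℝ) ^ 2 := (Real.sq_sqrt (Nat.cast_nonneg n)).symm
  have hexp := exp_half_sqrt_log_sq hn1
  have happ := happ x
  set q : ℝ := √(n : ℝ)
  set L : ℝ := √(Real.log n)
  have hq0 : 0 < q := by linarith
  have hL0 : 0 < L := by linarith
  have hdev : |n * P - normSqSum x| ≤ 12 * P * (q * L) := by
    rw [abs_of_nonneg (by linarith)]
    have : 12 * P * q * 1 ≤ 12 * P * q * L := by gcongr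
    linarith
  have hθ : |(-(L / σ / q))| ≤ 1 / σ * L / q := by
    rw [abs_neg, abs_of_nonneg (by positivity)]
    exact le_of_eq (by ring)
  obtain ⟨hcgf, happ⟩ := happ hdev _ hθ
  refine (hcgf.measure_le_le (by rw [neg_nonpos]; positivity) _).trans ?_
  have h1 := (abs_le.1 happ).2
  have h2 : n * V * (-(L / σ / q)) ^ 2 / 2 = L ^ 2 / 2 := by
    rw [hn, ← hVs]
    field_simp
  have h3 : -(-(L / σ / q)) * -(q * (σ * L + 14)) = -L ^ 2 - 14 * (L / σ) := by
    field_simp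
    ring
  have h4 : -((n * P - normSqSum x) / (1 + P)) * -(L / σ / q) ≤ 12 * (L / σ) := by
    have : (n * P - normSqSum x) / (1 + P) ≤ 12 * q := by
      rw [div_le_iff₀ (by positivity)]
      nlinarith
    have h5 := mul_le_mul_of_nonneg_right this (show 0 ≤ L / σ / q by positivity)
    have h6 : 12 * q * (L / σ / q) = 12 * (L / σ) := by field_simp
    linarith
  have h5 : L ≤ L / σ := by
    rw [le_div_iff₀ hσ]
    nlinarith
  have h6 : Real.exp (-(L ^ 2 / 2) - L) ≤ 1 / (q * L) / 2 := by
    rw [sub_eq_add_neg, Real.exp_add, Real.exp_neg, Real.exp_neg, hexp, ← mul_inv, div_div, one_div]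
    have := Real.quadratic_le_exp_of_nonneg hL0.le
    refine inv_anti₀ (by positivity) ?_
    rw [mul_assoc]
    refine mul_le_mul_of_nonneg_left ?_ hq0.le
    nlinarith
  -- Of the 14L/σ from the threshold, 12L/σ offsets the energy deficit of the shell. One further L/σ
  -- absorbs the approximation error 1, and the last gives exp(-L) ≤ 1/(2L).
  refine le_trans (Real.exp_le_exp.2 ?_) h6
  rw [h3]
  linarith

/-- Achievability: short-term codes with small error attaining the second-order expansion. -/
lemma eventually_exists_shortTerm_code {P : ℝ} (hP : 0 < P) :
    ∀ᶠ n : ℕ in atTop, ∃ (K : ℕ) (c : ChannelCode n K),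
      c.ShortTermPower (P * (1 - 2 * (1 / (√n * √(Real.log n))))) ∧
      c.avgError ≤ 1 / (√n * √(Real.log n)) ∧
      awgnCapacity P - √(awgnDispersion P) * √(Real.log n / n) - 16 * (1 / √n)
        ≤ Real.log K / n := by
  set g₀ : ℝ := 1 / 2 * Real.exp (-(121 / 2)) with hg₀
  have hg₀0 : 0 < g₀ := by positivity
  have hC : 0 < Real.log (1 + P) := Real.log_pos (by linarith)
  filter_upwards [eventually_le_gaussianVector_shell hP, eventually_excessInfo_le_measure_le hP,
    eventually_le_sqrt_log 1, eventually_le_sqrt 1, eventually_ge_atTop 1,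
    eventually_mul_sqrt_log_pow_le 1 1, eventually_mul_sqrt_log_pow_le 1 2,
    eventually_le_sqrt (Real.log (8 / g₀)),
    eventually_mul_sqrt_log_pow_le (17 / Real.log (1 + P)) 1]
    with n hshell htail hL hq hn1 hLq hL2q hgq hCq
  have hn : (n : ℝ) = √(n : ℝ) ^ 2 := (Real.sq_sqrt (Nat.cast_nonneg n)).symm
  have hlogn : Real.log n = √(Real.log n) ^ 2 :=
    (Real.sq_sqrt (Real.log_nonneg (by exact_mod_cast hn1))).symm
  have hσ1 : √(awgnDispersion P) ≤ 1 := Real.sqrt_le_one.2 (awgnDispersion_le_one hP)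
  rw [Real.sqrt_div (Real.log_nonneg (by exact_mod_cast hn1))]
  set q : ℝ := √(n : ℝ)
  set L : ℝ := √(Real.log n)
  set σ : ℝ := √(awgnDispersion P)
  have hq0 : 0 < q := by linarith
  have hL0 : 0 < L := by linarith
  have hn0 : (0 : ℝ) < n := by rw [hn]; positivity
  set δ : ℝ := 1 / (q * L) with hδ
  have hδ0 : 0 < δ := by positivity
  set g : ℝ := -(q * (σ * L + 14)) with hg
  set Γ : ℝ := (1 + P) ^ n * Real.exp g with hΓ
  have hΓ0 : 0 < Γ := by positivity
  -- The greedy condition needs K/Γ < (δ/2)g₀; rounding up at most doubles y, so the factor 1/8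
  -- leaves room. In ln y, the losses ln(qL) and ln(8/g₀) are at most q each, hence 16 = 14 + 1 + 1.
  set y : ℝ := δ * g₀ / 8 * Γ with hy
  have hy0 : 0 < y := by positivity
  have hlogy : n * Real.log (1 + P) - q * (σ * L) - 16 * q ≤ Real.log y := by
    have e : y = Γ / ((q * L) * (8 / g₀)) := by
      rw [hy, hδ]
      field_simp
    have h1 : Real.log (q * L) ≤ q := by
      calc Real.log (q * L) ≤ Real.log n := by
            apply Real.log_le_log (by positivity)
            rw [hn]
            nlinarith
        _ ≤ q := by
            rw [hlogn]
            linarith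
    have h2 : Real.log Γ = n * Real.log (1 + P) + g := by
      rw [hΓ, Real.log_mul (by positivity) (by positivity), Real.log_pow, Real.log_exp]
    have h3 : Real.log (q * L * (8 / g₀)) = Real.log (q * L) + Real.log (8 / g₀) :=
      Real.log_mul (by positivity) (by positivity)
    rw [e, Real.log_div (by positivity) (by positivity), h2, h3, hg]
    linarith
  have hy1 : 1 ≤ y := by
    have h1 : 0 ≤ Real.log y := by
      refine le_trans ?_ hlogy
      rw [div_mul_eq_mul_div, div_le_iff₀ hC] at hCq
      rw [hn]
      have h2 : σ * L ≤ 1 * L := by gcongr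
      have h3 : 0 ≤ q * (q * Real.log (1 + P) - σ * L - 16) := by
        apply mul_nonneg hq0.le
        linarith
      linarith
    by_contra h
    exact absurd h1 (not_le.2 (Real.log_neg hy0 (not_le.1 h)))
  set K : ℕ := ⌈y⌉₊ with hK
  have hKy : y ≤ K := Nat.le_ceil y
  have hK2 : (K : ℝ) ≤ 2 * y := by
    have := Nat.ceil_lt_add_one hy0.le
    linarith
  have hK0 : 0 < K := Nat.ceil_pos.2 hy0
  have hprob (x : Fin n → ℂ) : IsProbabilityMeasure ((awgnNoise n).map (x + ·)) :=
    Measure.isProbabilityMeasure_map (measurable_const_add x).aemeasurable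
  have hWU (x : Fin n → ℂ) {U : Set (Fin n → ℂ)} (hU : MeasurableSet U) :
      (awgnNoise n).map (x + ·) U = awgnNoise n {z | x + z ∈ U} :=
    Measure.map_apply (measurable_const_add x) hU
  have hT (x : Fin n → ℂ) : MeasurableSet {y | g < excessInfo P x (y - x)} :=
    measurableSet_lt measurable_const
      ((measurable_excessInfo P x).comp (measurable_id.sub_const x))
  obtain ⟨x, D, hxA, hD, hdisj, -, herr⟩ := exists_codewords_of_card_mul_lt
    (fun x : Fin n → ℂ => (awgnNoise n).map (x + ·)) (gaussianVector n P)
    (gaussianVector n (1 + P))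
    (A := {x | n * P - 12 * P * q ≤ normSqSum x ∧ normSqSum x ≤ n * P - 2 * P * q})
    ((measurableSet_le measurable_const measurable_normSqSum).inter
      (measurableSet_le measurable_normSqSum measurable_const))
    (T := fun x => {y | g < excessInfo P x (y - x)}) hT
    (κ := ENNReal.ofReal Γ⁻¹) (β := δ / 2) (δ := δ)
    (fun x hx => by
      rw [measureReal_def, hWU x (hT x).compl]
      have hle : normSqSum x ≤ n * P := hx.2.trans (by
        have : 0 < 2 * P * q := by positivity
        linarith)
      refine le_trans (le_of_eq ?_) (htail x hx.1 hle)
      rw [measureReal_def]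
      congr 2
      ext z
      simp)
    (fun x => gaussianVector_excessInfo_le hP x g)
    (fun U hU => by
      rw [← lintegral_awgnNoise_shift hP hU]
      refine (setLIntegral_le_lintegral _ _).trans (le_of_eq ?_)
      exact lintegral_congr fun x => hWU x hU) K (by
      have h1 : (K : ENNReal) * ENNReal.ofReal Γ⁻¹ = ENNReal.ofReal (K * Γ⁻¹) := by
        rw [ENNReal.ofReal_mul (Nat.cast_nonneg K), ENNReal.ofReal_natCast]
      have h2 : K * Γ⁻¹ < (δ - δ / 2) * g₀ := by
        rw [← div_eq_mul_inv, div_lt_iff₀ hΓ0]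
        have : 0 < δ * g₀ * Γ := by positivity
        linarith
      rw [h1]
      calc ENNReal.ofReal (K * Γ⁻¹) < ENNReal.ofReal ((δ - δ / 2) * g₀) := by
            rw [ENNReal.ofReal_lt_ofReal_iff (mul_pos (by linarith) hg₀0)]
            exact h2
        _ = ENNReal.ofReal (δ - δ / 2) * ENNReal.ofReal g₀ :=
            ENNReal.ofReal_mul (by linarith)
        _ ≤ _ := by gcongr)
  obtain ⟨dec, hdec, hdecD⟩ := exists_measurable_decoder hK0 hD hdisj
  refine ⟨K, ⟨x, dec, hdec⟩, fun j => ?_, ?_, ?_⟩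
  · have h1 : normSqSum (x j) ≤ n * P - 2 * P * q := (hxA j).2
    change normSqSum (x j) ≤ _
    refine h1.trans ?_
    -- The shell stays 2Pq below nP, more than the 2Pq/L by which the power constraint is reduced.
    have h2 : (n : ℝ) * (P * (1 - 2 * δ)) = n * P - 2 * P * (q / L) := by
      rw [hδ, hn]
      field_simp
    have h3 : q / L ≤ q := by
      rw [div_le_iff₀ hL0]
      nlinarith
    rw [h2]
    have := mul_le_mul_of_nonneg_left h3 (show 0 ≤ 2 * P by positivity)
    linarith
  · have hKR : (0 : ℝ) < K := by exact_mod_cast hK0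
    rw [ChannelCode.avgError, one_div, inv_mul_le_iff₀ hKR]
    have h1 (j : Fin K) : (awgnNoise n).real {z | dec (x j + z) ≠ j} ≤ δ := by
      refine le_trans ?_ (herr j)
      change _ ≤ ((awgnNoise n).map (x j + ·)).real (D j)ᶜ
      rw [measureReal_def ((awgnNoise n).map (x j + ·)), hWU _ (hD j).compl]
      exact measureReal_mono fun z hz hzD => hz (hdecD j _ hzD)
    simpa using Finset.sum_le_sum fun j (_ : j ∈ Finset.univ) => h1 j
  · rw [le_div_iff₀ hn0, awgnCapacity]
    have h1 := Real.log_le_log hy0 hKy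
    have e : (Real.log (1 + P) - σ * (L / q) - 16 * (1 / q)) * n
        = n * Real.log (1 + P) - q * (σ * L) - 16 * q := by
      rw [hn]
      field_simp
    rw [e]
    linarith

/-! ### Zero padding. -/

namespace ChannelCode

variable {n K M : ℕ}

lemma sum_energy_padZero (c : ChannelCode n K) (h : K ≤ M) :
    ∑ j, (c.padZero h).energy j = ∑ j, c.energy j := by
  obtain ⟨d, rfl⟩ := Nat.exists_eq_add_of_le h
  rw [Fin.sum_univ_add]
  simp [energy, padZero]

/-- The decoder still decides as before on the old messages; the added ones are charged a full error
each. -/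
lemma card_mul_avgError_padZero_le (c : ChannelCode n K) (h : K ≤ M) :
    M * (c.padZero h).avgError ≤ K * c.avgError + (M - K) := by
  have hK : (0 : ℝ) < K := by exact_mod_cast c.one_le_card
  have hM : (0 : ℝ) < M := by exact_mod_cast (c.padZero h).one_le_card
  obtain ⟨d, rfl⟩ := Nat.exists_eq_add_of_le h
  have e1 {m : ℕ} (hm : (0 : ℝ) < m) (S : ℝ) : (m : ℝ) * (1 / m * S) = S := by field_simp
  rw [avgError, avgError, e1 hK, e1 hM, Fin.sum_univ_add]
  have h1 (j : Fin K) : {z | (c.padZero h).dec ((c.padZero h).enc (Fin.castAdd d j) + z)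
      ≠ Fin.castAdd d j} = {z | c.dec (c.enc j + z) ≠ j} := by
    ext z
    simp [padZero, Fin.ext_iff]
  simp_rw [h1]
  gcongr
  refine (Finset.sum_le_sum fun j _ => measureReal_le_one).trans ?_
  simp

end ChannelCode

/-- The error constraint follows from M(1-ε) ≤ K(1-δ), the power constraint from K(1-2δ) ≤ M(1-ε).
The power reduction by 2δ rather than δ opens a gap Kδ ≥ 1 between them, wide enough for an integer
M. -/
lemma eventually_exists_padded_code {ρ ε : ℝ} (hρ : 0 < ρ) (hε₀ : 0 < ε) (hε₁ : ε < 1) :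
    ∀ᶠ n : ℕ in atTop, ∃ (K M : ℕ) (h : K ≤ M) (c : ChannelCode n K),
      c.ShortTermPower (ρ / (1 - ε) * (1 - 2 * (1 / (√n * √(Real.log n))))) ∧
      c.avgError ≤ 1 / (√n * √(Real.log n)) ∧
      awgnSecondOrder ρ ε n - 16 * (1 / √n) ≤ Real.log K / n ∧
      (c.padZero h).LongTermPower ρ ∧ (c.padZero h).avgError ≤ ε ∧
      |((M : ℝ) - K) / M - ε| ≤ 2 * (1 / (√n * √(Real.log n))) := by
  have hε : 0 < 1 - ε := sub_pos.2 hε₁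
  set P : ℝ := ρ / (1 - ε) with hPdef
  have hP : 0 < P := by positivity
  have hρP : ρ = P * (1 - ε) := by rw [hPdef]; field_simp
  have hC : 0 < Real.log (1 + P) := Real.log_pos (by linarith)
  filter_upwards [eventually_exists_shortTerm_code hP, eventually_le_sqrt_log 1,
    eventually_le_sqrt 1, eventually_le_sqrt (1 / ε), eventually_ge_atTop 1,
    eventually_le_sqrt (2 / Real.log (1 + P)), eventually_mul_sqrt_log_pow_le 2 1,
    eventually_mul_sqrt_log_pow_le (34 / Real.log (1 + P)) 1]
    with n hcode hL hq hqε hn1 hqC hL2 hLC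
  obtain ⟨K, c, hpow, herr, hrate⟩ := hcode
  have hn : (n : ℝ) = √(n : ℝ) ^ 2 := (Real.sq_sqrt (Nat.cast_nonneg n)).symm
  have hσ1 : √(awgnDispersion P) ≤ 1 := Real.sqrt_le_one.2 (awgnDispersion_le_one hP)
  have hlogK : √(n : ℝ) ≤ Real.log K := by
    have h := hrate
    rw [Real.sqrt_div (Real.log_nonneg (by exact_mod_cast hn1)), awgnCapacity] at h
    set q : ℝ := √(n : ℝ)
    set L : ℝ := √(Real.log n)
    have hq0 : 0 < q := by linarith
    have hn0 : (0 : ℝ) < n := by rw [hn]; positivity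
    rw [le_div_iff₀ hn0] at h
    have e : (Real.log (1 + P) - √(awgnDispersion P) * (L / q) - 16 * (1 / q)) * n
        = q * (q * Real.log (1 + P) - √(awgnDispersion P) * L - 16) := by
      rw [hn]
      field_simp
    rw [e] at h
    rw [div_mul_eq_mul_div, div_le_iff₀ hC] at hLC
    rw [div_le_iff₀ hC] at hqC
    have h2 : √(awgnDispersion P) * L ≤ 1 * L := by gcongr
    have h3 : q * 1 ≤ q * (q * Real.log (1 + P) - √(awgnDispersion P) * L - 16) := by
      apply mul_le_mul_of_nonneg_left _ hq0.le
      linarith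
    linarith
  set q : ℝ := √(n : ℝ)
  set L : ℝ := √(Real.log n)
  have hq0 : 0 < q := by linarith
  have hL0 : 0 < L := by linarith
  have hn0 : (0 : ℝ) < n := by rw [hn]; positivity
  have hK0 : (0 : ℝ) < K := by exact_mod_cast c.one_le_card
  set δ : ℝ := 1 / (q * L) with hδ
  have hδ0 : 0 < δ := by positivity
  have hδε : δ ≤ ε := by
    rw [hδ, div_le_iff₀ (by positivity)]
    rw [div_le_iff₀ hε₀] at hqε
    have : q * ε * 1 ≤ q * ε * L := by gcongr
    linarith
  have hKδ : 1 ≤ K * δ := by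
    rw [hδ, mul_one_div, le_div_iff₀ (by positivity), one_mul]
    have h1 : Real.exp q ≤ K := by
      rw [← Real.exp_log hK0]
      exact Real.exp_le_exp.2 hlogK
    have h2 := Real.quadratic_le_exp_of_nonneg hq0.le
    nlinarith
  have hX0 : 0 ≤ K * (1 - δ) / (1 - ε) := div_nonneg (mul_nonneg hK0.le (by linarith)) hε.le
  -- The largest M meeting the error constraint; δ ≤ ε ensures K ≤ M, and rounding lowers M(1-ε) by
  -- less than 1 ≤ Kδ.
  set M : ℕ := ⌊K * (1 - δ) / (1 - ε)⌋₊ with hMdef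
  have hKM : K ≤ M := by
    rw [hMdef, Nat.le_floor_iff hX0, le_div_iff₀ hε]
    gcongr
  have hKM' : (K : ℝ) ≤ M := by exact_mod_cast hKM
  have hM0 : (0 : ℝ) < M := by linarith
  have hMle : M * (1 - ε) ≤ K * (1 - δ) := by
    rw [← le_div_iff₀ hε]
    exact Nat.floor_le hX0
  have hMge : K * (1 - 2 * δ) ≤ M * (1 - ε) := by
    have h1 := Nat.lt_floor_add_one (K * (1 - δ) / (1 - ε))
    rw [div_lt_iff₀ hε, ← hMdef] at h1
    linarith
  refine ⟨K, M, hKM, c, hpow, herr, hrate, ?_, ?_, ?_⟩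
  · rw [ChannelCode.LongTermPower, c.sum_energy_padZero, one_div, inv_mul_le_iff₀ hM0]
    have h1 := hpow.longTermPower
    rw [ChannelCode.LongTermPower, one_div, inv_mul_le_iff₀ hK0] at h1
    refine h1.trans ?_
    rw [hρP]
    have := mul_le_mul_of_nonneg_left hMge (show 0 ≤ n * P by positivity)
    linarith
  · have h1 := c.card_mul_avgError_padZero_le hKM
    have h2 : K * c.avgError ≤ K * δ := by gcongr
    refine le_of_mul_le_mul_left ?_ hM0
    linarith
  · have e : ((M : ℝ) - K) / M - ε = (M * (1 - ε) - K) / M := by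
      field_simp
      ring
    rw [e, abs_div, abs_of_pos hM0, div_le_iff₀ hM0, abs_le]
    have h1 : δ * K ≤ δ * M := by gcongr
    have h2 : 0 < δ * K := by positivity
    constructor <;> linarith

/-! ### Assembly of both directions. -/

/-- The code with a single all-zero codeword. -/
noncomputable def trivialCode (n : ℕ) : ChannelCode n 1 := ⟨0, 0, measurable_const⟩

theorem theorem1 (ρ ε : ℝ) (hρ : 0 < ρ) (hε₀ : 0 < ε) (hε₁ : ε < 1) :
    -- the maximal rate is a genuine supremum at every blocklength, and its expansion is:
    (∀ n : ℕ, 1 ≤ n → BddAbove (longTermRates ρ n ε)) ∧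
    ((fun n : ℕ => maxLongTermRate ρ n ε - awgnSecondOrder ρ ε n)
      =O[atTop] fun n : ℕ => 1 / Real.sqrt n) ∧
    -- it is attained by zero-padding codes `c n` that obey a short-term constraint:
    ∃ (K M : ℕ → ℕ) (hKM : ∀ n, K n ≤ M n) (c : ∀ n, ChannelCode n (K n)) (P δ : ℕ → ℝ),
      -- `c n` has `K n` codewords of power at most `P n` and error probability at most `δ n`,
      (∀ᶠ n in atTop, (c n).ShortTermPower (P n) ∧ (c n).avgError ≤ δ n) ∧
      -- its rate is optimal, up to `O(1/√n)`, under these short-term constraints,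
      ((fun n : ℕ => Real.log (K n) / n - maxShortTermRate (P n) n (δ n))
        =O[atTop] fun n : ℕ => 1 / Real.sqrt n) ∧
      -- the padded code obeys the long-term constraints,
      (∀ᶠ n in atTop, ((c n).padZero (hKM n)).LongTermPower ρ ∧
        ((c n).padZero (hKM n)).avgError ≤ ε) ∧
      -- its rate has the expansion of the maximal rate,
      ((fun n : ℕ => Real.log (M n) / n - awgnSecondOrder ρ ε n)
        =O[atTop] fun n : ℕ => 1 / Real.sqrt n) ∧
      -- and `P n → ρ/(1-ε)`, `δ n → 0`, fraction of zero codewords `→ ε`, with rates.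
      ((fun n : ℕ => P n - ρ / (1 - ε))
        =O[atTop] fun n : ℕ => 1 / Real.sqrt (n * Real.log n)) ∧
      (δ =O[atTop] fun n : ℕ => 1 / Real.sqrt (n * Real.log n)) ∧
      ((fun n : ℕ => ((M n : ℝ) - K n) / M n - ε)
        =O[atTop] fun n : ℕ => 1 / Real.sqrt (n * Real.log n)) := by
  have hε : 0 < 1 - ε := sub_pos.2 hε₁
  have hP : 0 < ρ / (1 - ε) := by positivity
  have hbdd : ∀ n : ℕ, 1 ≤ n → BddAbove (longTermRates ρ n ε) := fun n hn =>
    bddAbove_longTermRates hρ hε₁ hn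
  have hδeq (n : ℕ) : 1 / √(n * Real.log n) = 1 / (√n * √(Real.log n)) := by
    rw [Real.sqrt_mul (Nat.cast_nonneg n)]
  have hconv := eventually_log_card_le hP hε₁
  have hcodes := eventually_exists_padded_code hρ hε₀ hε₁
  have hδε : ∀ᶠ n : ℕ in atTop, 1 / (√n * √(Real.log n)) ≤ ε := by
    filter_upwards [eventually_le_sqrt_log 1, eventually_le_sqrt (1 / ε)] with n hL hq
    have hq0 : 0 < √(n : ℝ) := lt_of_lt_of_le (by positivity) hq
    rw [div_le_iff₀ (by positivity)]
    rw [div_le_iff₀ hε₀] at hq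
    have : √n * ε * 1 ≤ √n * ε * √(Real.log n) := by gcongr
    linarith
  have hlong {n M : ℕ} {c : ChannelCode n M} (h : ∀ (M : ℕ) (c : ChannelCode n M) (ρ' ε' : ℝ),
      ε' ≤ ε → ρ' ≤ ρ / (1 - ε) * (1 - ε') → c.LongTermPower ρ' → c.avgError ≤ ε' →
      Real.log M / n ≤ awgnSecondOrder ρ ε n + 14 * (1 / √n)) (hp : c.LongTermPower ρ)
      (he : c.avgError ≤ ε) : Real.log M / n ≤ awgnSecondOrder ρ ε n + 14 * (1 / √n) :=
    h M c ρ ε le_rfl (le_of_eq (by field_simp)) hp he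
  have hmono {n K M : ℕ} (c : ChannelCode n K) (h : K ≤ M) :
      Real.log K / n ≤ Real.log M / n := by
    have : (0 : ℝ) < K := by exact_mod_cast c.one_le_card
    gcongr
  refine ⟨hbdd, ?_, ?_⟩
  · refine IsBigO.of_bound 16 ?_
    filter_upwards [hconv, hcodes, eventually_ge_atTop 1] with n hc ⟨K, M, h, c, _, _, hr, hl, he, _⟩ hn
    have hmem : Real.log M / n ∈ longTermRates ρ n ε := ⟨M, c.padZero h, hl, he, rfl⟩
    have h1 : Real.log M / n ≤ maxLongTermRate ρ n ε := le_csSup (hbdd n hn) hmem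
    have h2 : maxLongTermRate ρ n ε ≤ awgnSecondOrder ρ ε n + 14 * (1 / √n) := by
      refine csSup_le ⟨_, hmem⟩ ?_
      rintro r ⟨M', c', hp', he', rfl⟩
      exact hlong hc hp' he'
    have h3 := hmono c h
    have h4 : 0 ≤ 1 / √(n : ℝ) := by positivity
    rw [Real.norm_eq_abs, Real.norm_of_nonneg h4, abs_le]
    constructor <;> linarith
  · obtain ⟨N, hN⟩ := eventually_atTop.1 hcodes
    have hex (n : ℕ) : ∃ (K M : ℕ) (h : K ≤ M) (c : ChannelCode n K), N ≤ n →
        c.ShortTermPower (ρ / (1 - ε) * (1 - 2 * (1 / (√n * √(Real.log n))))) ∧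
          c.avgError ≤ 1 / (√n * √(Real.log n)) ∧
          awgnSecondOrder ρ ε n - 16 * (1 / √n) ≤ Real.log K / n ∧
          (c.padZero h).LongTermPower ρ ∧ (c.padZero h).avgError ≤ ε ∧
          |((M : ℝ) - K) / M - ε| ≤ 2 * (1 / (√n * √(Real.log n))) := by
      by_cases hn : N ≤ n
      · obtain ⟨K, M, h, c, hc⟩ := hN n hn
        exact ⟨K, M, h, c, fun _ => hc⟩
      · exact ⟨1, 1, le_rfl, trivialCode n, fun h => absurd h hn⟩
    choose K M hKM c hc using hex
    have hgood := (eventually_ge_atTop N).mono hc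
    refine ⟨K, M, hKM, c, fun n => ρ / (1 - ε) * (1 - 2 * (1 / (√n * √(Real.log n)))),
      fun n => 1 / (√n * √(Real.log n)), hgood.mono fun n hn => ⟨hn.1, hn.2.1⟩, ?_,
      hgood.mono fun n hn => ⟨hn.2.2.2.1, hn.2.2.2.2.1⟩, ?_, ?_, ?_, ?_⟩
    · refine IsBigO.of_bound 30 ?_
      filter_upwards [hconv, hgood, hδε] with n hconv ⟨hp, he, hr, _⟩ hδ
      have hδ0 : 0 ≤ 1 / (√(n : ℝ) * √(Real.log n)) := by positivity
      have hub : ∀ r ∈ shortTermRates (ρ / (1 - ε) * (1 - 2 * (1 / (√n * √(Real.log n))))) n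
          (1 / (√n * √(Real.log n))), r ≤ awgnSecondOrder ρ ε n + 14 * (1 / √n) := by
        rintro r ⟨M', c', hp', he', rfl⟩
        -- The converse with ε' = δ applies to every competing short-term code, because P(1-2δ) ≤
        -- P(1-δ).
        refine hconv M' c' _ _ hδ ?_ hp'.longTermPower he'
        gcongr
        linarith
      have hmem : Real.log (K n) / n ∈ shortTermRates
          (ρ / (1 - ε) * (1 - 2 * (1 / (√n * √(Real.log n))))) n
          (1 / (√n * √(Real.log n))) := ⟨K n, c n, hp, he, rfl⟩
      have h1 := le_csSup ⟨_, hub⟩ hmem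
      have h2 := csSup_le ⟨_, hmem⟩ hub
      have h4 : 0 ≤ 1 / √(n : ℝ) := by positivity
      rw [Real.norm_eq_abs, Real.norm_of_nonneg h4, abs_le, maxShortTermRate]
      constructor <;> linarith
    · refine IsBigO.of_bound 16 ?_
      filter_upwards [hconv, hgood] with n hconv ⟨_, _, hr, hl, he, _⟩
      -- The padded rate is sandwiched: the converse bounds it above, and K ≤ M bounds it below by
      -- the short-term rate.
      have h1 := hlong hconv hl he
      have h2 := hmono (c n) (hKM n)
      have h4 : 0 ≤ 1 / √(n : ℝ) := by positivity
      rw [Real.norm_eq_abs, Real.norm_of_nonneg h4, abs_le]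
      constructor <;> linarith
    · refine IsBigO.of_bound (2 * (ρ / (1 - ε))) (Eventually.of_forall fun n => ?_)
      rw [hδeq]
      have e : ρ / (1 - ε) * (1 - 2 * (1 / (√n * √(Real.log n)))) - ρ / (1 - ε)
          = -(2 * (ρ / (1 - ε)) * (1 / (√n * √(Real.log n)))) := by ring
      rw [e, norm_neg, norm_mul, Real.norm_of_nonneg (show 0 ≤ 2 * (ρ / (1 - ε)) by positivity)]
    · refine IsBigO.of_bound 1 (Eventually.of_forall fun n => ?_)
      rw [hδeq, one_mul]
    · refine IsBigO.of_bound 2 ?_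
      filter_upwards [hgood] with n hn
      rw [hδeq, Real.norm_eq_abs, Real.norm_of_nonneg (by positivity)]
      exact hn.2.2.2.2.2
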